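/- There is an absolute constant $C_0>0$ such that the following holds. Let $[n]=\{1,\dots,n\}$ be partitioned into $r$ clusters $C_1^*,\dots,C_r^*$, let $\theta\in\mathbb{R}_{\ge 0}^n$ with $\max_i\theta_i=1$, and let $B\in\mathbb{R}_{\ge0}^{r\times r}$ be symmetric, with $\theta_i\theta_jB_{ab}\in[0,1]$ for all $i\in C_a^*$, $j\in C_b^*$ (including $i=j$). Consider the random graph on $[n]$ in which distinct nodes $i\in C_a^*$ and $j\in C_b^*$ are joined with probability $\theta_i\theta_jB_{ab}$, independently over all unordered pairs. Assume the $\mathcal F(n,r,p,q,g)$-model: $B_{aa}=p$ for all $a$, $B_{ab}=q$ for all $a<b$, and $\sum_{i\in C_a^*}\theta_i=g$ for all $a$. Let $\delta>0$ and $\lambda$ satisfy $$p-q>2\delta,\qquad \frac{q+\delta}{(p+(r-1)q)^2g^2}<\lambda<\frac{p-\delta}{(p+(r-1)q)^2g^2}.$$ Let $A$ be the adjacency matrix of the graph, $d$ its degree vector and $D=\mathrm{diag}(d)$. Let $\widehat Y$ be a maximizer of $\langle Y,A-\lambda dd^\top\rangle$ over the $n\times n$ matrices $Y\succeq0$ with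 $0\le Y_{ij}\le1$ and $Y_{ii}=1$ for all $i,j$, and put $\widehat W=\widehat YD$. Consider the doubly-weighted $\ell_1$ $k$-median problem of minimizing $\|D(\Psi X-\widehat W)\|_1$ (the sum of the absolute values of the entries) over the membership matrices $\Psi\in\{0,1\}^{n\times r}$ (each row has exactly one entry $1$) and the matrices $X\in\mathbb{R}^{r\times n}$ each of whose rows is a row of $\widehat W$. Let $\Psi^*$ be the membership matrix of $C^*_1,\dots,C^*_r$. Then, with probability at least $0.99-2(e/2)^{-2n}$, for every such $\widehat Y$ and every feasible $(\check\Psi,\check X)$ of this problem whose objective value is at most $\frac{20}{3}$ times the minimum, $$\min_{\Pi}\ \sum_{i\,:\,(\check\Psi\Pi)_{i\bullet}\ne\Psi^*_{i\bullet}}\theta_i\ \le\ C_0\,\frac r\delta\Big(\frac ng+r\sqrt{np}\Big),$$ where $\Pi$ ranges over the $r\times r$ permutation matrices and $M_{i\bullet}$ denotes the $i$-th row of $M$. -/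

import Mathlib

open MeasureTheory ProbabilityTheory

namespace DCSBM

/-- The degree-corrected stochastic block model on the nodes `Fin n`. The map `σ` sends a node to
the label of its true cluster, `θ` are the degree heterogeneity parameters (normalized to have
maximum `1`), `B` is the connectivity matrix, and `G` is the random graph: distinct nodes `i`, `j`
are joined with probability `θ i * θ j * B (σ i) (σ j)`, independently over all unordered pairs.
The numbers `θ i * θ j * B (σ i) (σ j)` lie in `[0, 1]` for all `i` and `j`. -/
structure IsDCSBM {Ω : Type*} [MeasurableSpace Ω] (μ : Measure Ω) {n r : ℕ}
    (σ : Fin n → Fin r) (θ : Fin n → ℝ) (B : Matrix (Fin r) (Fin r) ℝ)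
    (G : Ω → SimpleGraph (Fin n)) : Prop where
  theta_nonneg : ∀ i, 0 ≤ θ i
  theta_le_one : ∀ i, θ i ≤ 1
  exists_theta_eq_one : ∃ i, θ i = 1
  B_nonneg : ∀ a b, 0 ≤ B a b
  B_symm : B.IsSymm
  prob_le_one : ∀ i j, θ i * θ j * B (σ i) (σ j) ≤ 1
  measurableSet_adj : ∀ i j, MeasurableSet {ω | (G ω).Adj i j}
  prob_adj : ∀ i j, i ≠ j → μ.real {ω | (G ω).Adj i j} = θ i * θ j * B (σ i) (σ j)
  indep_adj : iIndepSet
    (fun e : {e : Fin n × Fin n // e.1 < e.2} => {ω | (G ω).Adj e.1.1 e.1.2}) μ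

/-- The sum of the degree heterogeneity parameters over the true cluster `a`. -/
def clusterWeight {n r : ℕ} (σ : Fin n → Fin r) (θ : Fin n → ℝ) (a : Fin r) : ℝ :=
  ∑ i with σ i = a, θ i

/-- A degree-corrected stochastic block model obeys the `F(n, r, p, q, g)`-model. -/
structure IsFModel {Ω : Type*} [MeasurableSpace Ω] (μ : Measure Ω) {n r : ℕ}
    (p q g : ℝ) (σ : Fin n → Fin r) (θ : Fin n → ℝ) (B : Matrix (Fin r) (Fin r) ℝ)
    (G : Ω → SimpleGraph (Fin n)) : Prop extends IsDCSBM μ σ θ B G where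
  B_diag : ∀ a, B a a = p
  B_offDiag : ∀ a b, a < b → B a b = q
  clusterWeight_eq : ∀ a, clusterWeight σ θ a = g

open Classical in
/-- The real adjacency matrix of a graph. -/
noncomputable def adj {n : ℕ} (G : SimpleGraph (Fin n)) : Matrix (Fin n) (Fin n) ℝ :=
  G.adjMatrix ℝ

/-- The vector of row sums; for an adjacency matrix this is the degree vector. -/
def deg {n : ℕ} (A : Matrix (Fin n) (Fin n) ℝ) (i : Fin n) : ℝ :=
  ∑ j, A i j

/-- The constraints of the convex relaxation. -/
structure CvxFeasible {n : ℕ} (Y : Matrix (Fin n) (Fin n) ℝ) : Prop where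
  posSemidef : Y.PosSemidef
  nonneg : ∀ i j, 0 ≤ Y i j
  le_one : ∀ i j, Y i j ≤ 1
  diag_eq_one : ∀ i, Y i i = 1

/-- The objective `⟨Y, A - lam d dᵀ⟩` of the convex relaxation. -/
def cvxObjective {n : ℕ} (A : Matrix (Fin n) (Fin n) ℝ) (lam : ℝ)
    (Y : Matrix (Fin n) (Fin n) ℝ) : ℝ :=
  ∑ i, ∑ j, Y i j * (A i j - lam * (deg A i * deg A j))

/-- `Y` is an optimal solution of the convex relaxation. -/
def IsCvxOptimal {n : ℕ} (A : Matrix (Fin n) (Fin n) ℝ) (lam : ℝ)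
    (Y : Matrix (Fin n) (Fin n) ℝ) : Prop :=
  CvxFeasible Y ∧ ∀ Y', CvxFeasible Y' → cvxObjective A lam Y' ≤ cvxObjective A lam Y

/-- Membership matrices of assignments of `n` nodes to `r` clusters. -/
structure IsMembership {n r : ℕ} (Ψ : Matrix (Fin n) (Fin r) ℝ) : Prop where
  zero_or_one : ∀ i a, Ψ i a = 0 ∨ Ψ i a = 1
  existsUnique : ∀ i, ∃! a, Ψ i a = 1

/-- The membership matrix of the true clusters. -/
def trueMembership {n r : ℕ} (σ : Fin n → Fin r) : Matrix (Fin n) (Fin r) ℝ :=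
  Matrix.of fun i a => if σ i = a then 1 else 0

/-- The matrix `Y * diag d` of column-weighted features. -/
def featureMatrix {n : ℕ} (A Y : Matrix (Fin n) (Fin n) ℝ) : Matrix (Fin n) (Fin n) ℝ :=
  Y * Matrix.diagonal (deg A)

/-- The constraints of the `k`-median problem: `Ψ` is a membership matrix, and every row of `X`
is a row of `W`. -/
def KMedianFeasible {n r : ℕ} (W : Matrix (Fin n) (Fin n) ℝ)
    (Ψ : Matrix (Fin n) (Fin r) ℝ) (X : Matrix (Fin r) (Fin n) ℝ) : Prop :=
  IsMembership Ψ ∧ ∀ a, ∃ i, ∀ j, X a j = W i j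

/-- The objective of the `k`-median problem: the entrywise `ℓ₁` norm of `diag d * (Ψ X - W)`. -/
def kMedianCost {n r : ℕ} (d : Fin n → ℝ) (W : Matrix (Fin n) (Fin n) ℝ)
    (Ψ : Matrix (Fin n) (Fin r) ℝ) (X : Matrix (Fin r) (Fin n) ℝ) : ℝ :=
  ∑ i, ∑ j, |(Matrix.diagonal d * (Ψ * X - W)) i j|

/-- `(Ψ, X)` is an exact optimal solution of the `k`-median problem. -/
def IsKMedianOptimal {n r : ℕ} (d : Fin n → ℝ) (W : Matrix (Fin n) (Fin n) ℝ)
    (Ψ : Matrix (Fin n) (Fin r) ℝ) (X : Matrix (Fin r) (Fin n) ℝ) : Prop :=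
  KMedianFeasible W Ψ X ∧
    ∀ (Ψ' : Matrix (Fin n) (Fin r) ℝ) (X' : Matrix (Fin r) (Fin n) ℝ),
      KMedianFeasible W Ψ' X' → kMedianCost d W Ψ X ≤ kMedianCost d W Ψ' X'

/-- `(Ψ, X)` is feasible for the `k`-median problem, with cost at most `20 / 3` times the
optimal cost. -/
def IsKMedianApprox {n r : ℕ} (d : Fin n → ℝ) (W : Matrix (Fin n) (Fin n) ℝ)
    (Ψ : Matrix (Fin n) (Fin r) ℝ) (X : Matrix (Fin r) (Fin n) ℝ) : Prop :=
  KMedianFeasible W Ψ X ∧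
    ∃ (Ψ₀ : Matrix (Fin n) (Fin r) ℝ) (X₀ : Matrix (Fin r) (Fin n) ℝ),
      IsKMedianOptimal d W Ψ₀ X₀ ∧ kMedianCost d W Ψ X ≤ 20 / 3 * kMedianCost d W Ψ₀ X₀

open Classical in
/-- The set of nodes misclassified by `Ψ` after the columns are permuted by the permutation
matrix of `π`. -/
noncomputable def misclassified {n r : ℕ} (σ : Fin n → Fin r) (Ψ : Matrix (Fin n) (Fin r) ℝ)
    (π : Equiv.Perm (Fin r)) : Finset (Fin n) :=
  Finset.univ.filter fun i => ∃ a, (Ψ * π.permMatrix ℝ) i a ≠ trueMembership σ i a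

/-- The `θ`-weight of the misclassified nodes, minimized over all relabelings of the clusters. -/
noncomputable def misclassifiedWeight {n r : ℕ} (σ : Fin n → Fin r) (θ : Fin n → ℝ)
    (Ψ : Matrix (Fin n) (Fin r) ℝ) : ℝ :=
  (Finset.univ : Finset (Equiv.Perm (Fin r))).inf' Finset.univ_nonempty
    fun π => ∑ i ∈ misclassified σ Ψ π, θ i

end DCSBM

/-! Let `Z` be the true cluster matrix, `K = p + (r - 1) q`, `H = g K` and `L = r g H`. With the
diagonal included, expected degrees are exactly `θ i * H`, and `L` is the total expected degree.
Hence the population matrix `P - lam f fᵀ` has entries `θ i * θ j * (B (σ i) (σ j) - lam H ^ 2)`,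
and the window for `lam` says that the bracket is at least `δ` within clusters and at most `-δ`
across them. Replacing `Z` by a feasible `Y` therefore costs at least `δ` times their `θ`-weighted
`ℓ₁` distance, and optimality of `Y` makes this distance as small as the noise allows
(`IsCvxOptimal.mul_weightedDist_le`).

The only random input is a cut-norm bound on `A - P`. When `n ≤ L`, a Chernoff bound and a union
over the `4 ^ n` pairs of sign vectors give `N = 7 √(n L)`, with failure probability at most `(e /
2) ^ (-2 n)`. Grothendieck's inequality (`sum_mul_posSemidef_le`) carries this to pairings with
positive semidefinite matrices of unit diagonal, and testing against the all-ones vector bounds the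
degree errors in `ℓ₁`. The same degree bound exchanges the weights `deg A` of the rounding step with
`H θ`.

Rounding is deterministic. An approximate `k`-median solution yields rows close to those of `Z`, and
a Markov and counting argument (`exists_perm_sum_misclassified_le`) turns closeness into a
relabelling with few errors by weight. If `n > L`, the total weight `r g` is already below the `n /
g` term; this is the only use of that term. -/

namespace DCSBM

/-! ### Grothendieck's inequality by truncated Rademacher rounding -/

/-- The average of a function over the cube of signs. -/
noncomputable def signAvg {d : ℕ} (F : (Fin d → Bool) → ℝ) : ℝ := (∑ ε, F ε) / 2 ^ d

/-- The sign encoded by a Boolean. -/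
def boolSign (b : Bool) : ℝ := if b then 1 else -1

/-- The Rademacher sum with coefficients `u`. -/
def rademacherSum {d : ℕ} (u : Fin d → ℝ) (ε : Fin d → Bool) : ℝ := ∑ k, u k * boolSign (ε k)

lemma signAvg_succ {d : ℕ} (F : (Fin (d + 1) → Bool) → ℝ) :
    signAvg F = (signAvg (fun ε => F (Fin.cons true ε)) +
      signAvg (fun ε => F (Fin.cons false ε))) / 2 := by
  unfold signAvg
  have h : ∑ ε, F ε = ∑ x : Bool × (Fin d → Bool), F (Fin.cons x.1 x.2) :=
    (Fintype.sum_equiv (Fin.consEquiv (fun _ => Bool)) _ _ (fun _ => rfl)).symm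
  rw [h, Fintype.sum_prod_type, Fintype.sum_bool, pow_succ]
  ring

lemma signAvg_add {d : ℕ} (F F' : (Fin d → Bool) → ℝ) :
    signAvg (fun ε => F ε + F' ε) = signAvg F + signAvg F' := by
  simp [signAvg, Finset.sum_add_distrib, add_div]

lemma signAvg_const_mul {d : ℕ} (c : ℝ) (F : (Fin d → Bool) → ℝ) :
    signAvg (fun ε => c * F ε) = c * signAvg F := by
  simp [signAvg, ← Finset.mul_sum, mul_div_assoc]

lemma signAvg_const {d : ℕ} (c : ℝ) : signAvg (fun _ : Fin d → Bool => c) = c := by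
  simp [signAvg]

lemma signAvg_mono {d : ℕ} {F F' : (Fin d → Bool) → ℝ} (h : ∀ ε, F ε ≤ F' ε) :
    signAvg F ≤ signAvg F' := by
  unfold signAvg
  gcongr
  exact h _

lemma signAvg_sum {d : ℕ} {ι : Type*} (s : Finset ι) (F : ι → (Fin d → Bool) → ℝ) :
    signAvg (fun ε => ∑ i ∈ s, F i ε) = ∑ i ∈ s, signAvg (F i) := by
  simp only [signAvg]
  rw [Finset.sum_comm, Finset.sum_div]

lemma rademacherSum_cons {d : ℕ} (u : Fin (d + 1) → ℝ) (b : Bool) (ε : Fin d → Bool) :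
    rademacherSum u (Fin.cons b ε) = u 0 * boolSign b + rademacherSum (fun k => u k.succ) ε := by
  simp [rademacherSum, Fin.sum_univ_succ]

lemma signAvg_rademacherSum_mul {d : ℕ} (u v : Fin d → ℝ) :
    signAvg (fun ε => rademacherSum u ε * rademacherSum v ε) = ∑ k, u k * v k := by
  induction d with
  | zero => simp [signAvg, rademacherSum]
  | succ d ih =>
    rw [signAvg_succ, ← signAvg_add, Fin.sum_univ_succ, ← ih]
    have : (fun ε : Fin d → Bool =>
        rademacherSum u (Fin.cons true ε) * rademacherSum v (Fin.cons true ε) +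
        rademacherSum u (Fin.cons false ε) * rademacherSum v (Fin.cons false ε)) =
        fun ε => 2 * (u 0 * v 0) +
          2 * (rademacherSum (fun k => u k.succ) ε * rademacherSum (fun k => v k.succ) ε) := by
      funext ε
      simp only [rademacherSum_cons, boolSign]
      norm_num
      ring
    rw [this, signAvg_add, signAvg_const, signAvg_const_mul]
    ring

/-- Averaging over one sign kills the odd cross terms, so the induction reduces to `a ^ 4 + 6 a ^ 2
s + 3 s ^ 2 ≤ 3 (a ^ 2 + s) ^ 2`. -/
lemma signAvg_rademacherSum_pow_four_le {d : ℕ} (u : Fin d → ℝ) :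
    signAvg (fun ε => rademacherSum u ε ^ 4) ≤ 3 * (∑ k, u k ^ 2) ^ 2 := by
  induction d with
  | zero => simp [signAvg, rademacherSum]
  | succ d ih =>
    rw [signAvg_succ, ← signAvg_add, Fin.sum_univ_succ]
    have : (fun ε : Fin d → Bool => rademacherSum u (Fin.cons true ε) ^ 4 +
        rademacherSum u (Fin.cons false ε) ^ 4) =
        fun ε => (2 * u 0 ^ 4 + 12 * u 0 ^ 2 * (rademacherSum (fun k => u k.succ) ε *
          rademacherSum (fun k => u k.succ) ε)) +
          2 * (rademacherSum (fun k => u k.succ) ε ^ 4) := by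
      funext ε
      simp only [rademacherSum_cons, boolSign]
      norm_num
      ring
    rw [this, signAvg_add, signAvg_add, signAvg_const, signAvg_const_mul, signAvg_const_mul,
      signAvg_rademacherSum_mul]
    have h := ih (fun k => u k.succ)
    have h2 : ∑ k : Fin d, u k.succ * u k.succ = ∑ k : Fin d, u k.succ ^ 2 := by
      simp [sq]
    rw [h2]
    nlinarith [sq_nonneg (u 0 ^ 2)]

/-- The truncation of a real number to `[-1, 1]`. -/
noncomputable def clamp (x : ℝ) : ℝ := max (-1) (min 1 x)

lemma abs_clamp_le (x : ℝ) : |clamp x| ≤ 1 := by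
  rw [abs_le]
  exact ⟨le_max_left _ _, max_le (by norm_num) (min_le_left _ _)⟩

lemma clamp_sq_le (x : ℝ) : clamp x ^ 2 ≤ x ^ 2 := by
  unfold clamp
  rcases le_total 1 x with h | h
  · rw [min_eq_left h, max_eq_right (by norm_num)]; nlinarith
  · rw [min_eq_right h]
    rcases le_total (-1) x with h' | h'
    · rw [max_eq_right h']
    · rw [max_eq_left h']; nlinarith

/-- For `x ≥ 1` the root inequality `x - 1 ≤ x ^ 2 / 4` is `(x - 2) ^ 2 ≥ 0`. It lets a fourth
moment control the truncation error in mean square. -/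
lemma sub_clamp_sq_le (x : ℝ) : (x - clamp x) ^ 2 ≤ x ^ 4 / 16 := by
  have key : |x - clamp x| ≤ x ^ 2 / 4 := by
    unfold clamp
    rcases le_total 1 x with h | h
    · rw [min_eq_left h, max_eq_right (by norm_num), abs_of_nonneg (by linarith)]
      nlinarith [sq_nonneg (x - 2)]
    · rw [min_eq_right h]
      rcases le_total (-1) x with h' | h'
      · rw [max_eq_right h']; simp; positivity
      · rw [max_eq_left h', abs_of_nonpos (by linarith)]
        nlinarith [sq_nonneg (x + 2)]
  calc (x - clamp x) ^ 2 = |x - clamp x| ^ 2 := (sq_abs _).symm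
    _ ≤ (x ^ 2 / 4) ^ 2 := by gcongr
    _ = x ^ 4 / 16 := by ring

/-- The bilinear form of `M`. -/
def bilin {ι : Type*} [Fintype ι] (M : Matrix ι ι ℝ) (x y : ι → ℝ) : ℝ :=
  ∑ i, ∑ j, M i j * (x i * y j)

/-- The values `∑ M i j ⟪u i, v j⟫` over families of vectors in the unit ball. -/
def grothendieckValues {ι : Type*} [Fintype ι] (M : Matrix ι ι ℝ) : Set ℝ :=
  {s | ∃ (d : ℕ) (u v : ι → Fin d → ℝ), (∀ i, ∑ k, u i k ^ 2 ≤ 1) ∧ (∀ i, ∑ k, v i k ^ 2 ≤ 1) ∧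
    s = ∑ k, bilin M (fun i => u i k) (fun j => v j k)}

section
variable {ι : Type*} [Fintype ι] (M : Matrix ι ι ℝ)

lemma sum_bilin_eq {κ : Type*} [Fintype κ] (u v : ι → κ → ℝ) :
    ∑ k, bilin M (fun i => u i k) (fun j => v j k) =
      ∑ i, ∑ j, M i j * ∑ k, u i k * v j k := by
  unfold bilin
  rw [Finset.sum_comm]
  refine Finset.sum_congr rfl fun i _ => ?_
  rw [Finset.sum_comm]
  simp [Finset.mul_sum]

/-- Finiteness of the supremum is what allows it to be absorbed in the self-bounding estimate for
Grothendieck's inequality. -/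
lemma bddAbove_grothendieckValues : BddAbove (grothendieckValues M) := by
  refine ⟨∑ i, ∑ j, |M i j|, ?_⟩
  rintro s ⟨d, u, v, hu, hv, rfl⟩
  rw [sum_bilin_eq]
  refine Finset.sum_le_sum fun i _ => Finset.sum_le_sum fun j _ => ?_
  have hle : |∑ k, u i k * v j k| ≤ 1 := by
    refine abs_le_one_iff_mul_self_le_one.2 ?_
    rw [← sq]
    calc (∑ k, u i k * v j k) ^ 2 ≤ (∑ k, u i k ^ 2) * ∑ k, v j k ^ 2 :=
        Finset.sum_mul_sq_le_sq_mul_sq _ _ _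
      _ ≤ 1 * 1 := by
        gcongr
        · exact hu i
        · exact hv j
      _ = 1 := by norm_num
  calc M i j * ∑ k, u i k * v j k ≤ |M i j * ∑ k, u i k * v j k| := le_abs_self _
    _ = |M i j| * |∑ k, u i k * v j k| := abs_mul _ _
    _ ≤ |M i j| * 1 := by gcongr
    _ = |M i j| := mul_one _

lemma sum_bilin_le_mul_sSup {κ : Type*} [Fintype κ] (u v : ι → κ → ℝ) {α β : ℝ} (hα : 0 < α)
    (hβ : 0 < β) (hu : ∀ i, ∑ k, u i k ^ 2 ≤ α ^ 2) (hv : ∀ i, ∑ k, v i k ^ 2 ≤ β ^ 2) :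
    ∑ k, bilin M (fun i => u i k) (fun j => v j k) ≤ α * β * sSup (grothendieckValues M) := by
  let e := (Fintype.equivFin κ).symm
  have hscale : ∀ (w : ι → κ → ℝ) (γ : ℝ), 0 < γ → (∀ i, ∑ k, w i k ^ 2 ≤ γ ^ 2) →
      ∀ i, ∑ k, (w i (e k) / γ) ^ 2 ≤ 1 := by
    intro w γ hγ hw i
    rw [Equiv.sum_comp e (fun k => (w i k / γ) ^ 2)]
    simp only [div_pow]
    rw [← Finset.sum_div, div_le_one (by positivity)]
    exact hw i
  have h := le_csSup (bddAbove_grothendieckValues M)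
    ⟨_, fun i k => u i (e k) / α, fun i k => v i (e k) / β, hscale u α hα hu, hscale v β hβ hv, rfl⟩
  rw [Equiv.sum_comp e (fun k => bilin M (fun i => u i k / α) (fun j => v j k / β))] at h
  have h2 : ∑ k, bilin M (fun i => u i k) (fun j => v j k) =
      α * β * ∑ k, bilin M (fun i => u i k / α) (fun j => v j k / β) := by
    unfold bilin
    simp only [Finset.mul_sum]
    refine Finset.sum_congr rfl fun k _ => Finset.sum_congr rfl fun i _ =>
      Finset.sum_congr rfl fun j _ => ?_
    field_simp
  rw [h2]
  gcongr

/-- Functions on the sign cube are themselves vectors with `2 ^ d` coordinates, so the supremum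
controls them; the normalisation of the average contributes `√(2 ^ d)` to each factor. -/
lemma bilin_signAvg_le {d : ℕ} (F F' : ι → (Fin d → Bool) → ℝ) {α β : ℝ} (hα : 0 < α)
    (hβ : 0 < β) (hF : ∀ i, signAvg (fun ε => F i ε ^ 2) ≤ α ^ 2)
    (hF' : ∀ i, signAvg (fun ε => F' i ε ^ 2) ≤ β ^ 2) :
    signAvg (fun ε => bilin M (fun i => F i ε) (fun j => F' j ε)) ≤
      α * β * sSup (grothendieckValues M) := by
  have h2 : (0 : ℝ) < 2 ^ d := by positivity
  have hs : (0 : ℝ) < √(2 ^ d) := Real.sqrt_pos.2 h2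
  have hsq : √((2 : ℝ) ^ d) ^ 2 = 2 ^ d := Real.sq_sqrt h2.le
  have key := sum_bilin_le_mul_sSup M F F' (mul_pos hα hs) (mul_pos hβ hs)
    (fun i => by rw [mul_pow, hsq]; exact (div_le_iff₀ h2).1 (hF i))
    (fun i => by rw [mul_pow, hsq]; exact (div_le_iff₀ h2).1 (hF' i))
  unfold signAvg
  rw [div_le_iff₀ h2]
  refine key.trans (le_of_eq ?_)
  linear_combination α * β * sSup (grothendieckValues M) * hsq

lemma bilin_add_left (x x' y : ι → ℝ) :
    bilin M (fun i => x i + x' i) y = bilin M x y + bilin M x' y := by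
  simp [bilin, add_mul, mul_add, Finset.sum_add_distrib]

lemma bilin_add_right (x y y' : ι → ℝ) :
    bilin M x (fun i => y i + y' i) = bilin M x y + bilin M x y' := by
  simp [bilin, mul_add, Finset.sum_add_distrib]

/-- Grothendieck's inequality with constant `8`. -/
lemma grothendieck_le {N : ℝ}
    (hN : ∀ x y : ι → ℝ, (∀ i, |x i| ≤ 1) → (∀ i, |y i| ≤ 1) → bilin M x y ≤ N)
    {d : ℕ} (u v : ι → Fin d → ℝ) (hu : ∀ i, ∑ k, u i k ^ 2 ≤ 1)
    (hv : ∀ i, ∑ k, v i k ^ 2 ≤ 1) :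
    ∑ k, bilin M (fun i => u i k) (fun j => v j k) ≤ 8 * N := by
  set S := sSup (grothendieckValues M) with hS
  have step : ∀ s ∈ grothendieckValues M, s ≤ N + 7 / 8 * S := by
    rintro s ⟨d, u, v, hu, hv, rfl⟩
    -- The fourth moment gives `3 / 16 = 48 / 256 ≤ (7 / 16) ^ 2`.
    have h1 : ∀ w : ι → Fin d → ℝ, (∀ i, ∑ k, w i k ^ 2 ≤ 1) →
        ∀ i, signAvg (fun ε => (rademacherSum (w i) ε - clamp (rademacherSum (w i) ε)) ^ 2) ≤
          (7 / 16) ^ 2 := by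
      intro w hw i
      calc _ ≤ signAvg (fun ε => 1 / 16 * rademacherSum (w i) ε ^ 4) := by
            refine signAvg_mono fun ε => ?_
            have := sub_clamp_sq_le (rademacherSum (w i) ε)
            linarith
        _ ≤ 1 / 16 * (3 * (∑ k, w i k ^ 2) ^ 2) := by
            rw [signAvg_const_mul]
            have := signAvg_rademacherSum_pow_four_le (w i)
            linarith
        _ ≤ 1 / 16 * (3 * 1 ^ 2) := by
            have h0 : 0 ≤ ∑ k, w i k ^ 2 := Finset.sum_nonneg fun _ _ => sq_nonneg _
            gcongr
            exact hw i
        _ ≤ _ := by norm_num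
    have h2 : ∀ w : ι → Fin d → ℝ, (∀ i, ∑ k, w i k ^ 2 ≤ 1) →
        ∀ i, signAvg (fun ε => rademacherSum (w i) ε ^ 2) ≤ 1 ^ 2 := by
      intro w hw i
      simp only [sq]
      rw [signAvg_rademacherSum_mul]
      simpa [sq] using hw i
    have h3 : ∀ w : ι → Fin d → ℝ, (∀ i, ∑ k, w i k ^ 2 ≤ 1) →
        ∀ i, signAvg (fun ε => clamp (rademacherSum (w i) ε) ^ 2) ≤ 1 ^ 2 := fun w hw i =>
      (signAvg_mono fun ε => clamp_sq_le _).trans (h2 w hw i)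
    have e0 : ∑ k, bilin M (fun i => u i k) (fun j => v j k) =
        signAvg (fun ε => bilin M (fun i => rademacherSum (u i) ε)
          (fun j => rademacherSum (v j) ε)) := by
      rw [sum_bilin_eq]
      unfold bilin
      rw [signAvg_sum]
      refine Finset.sum_congr rfl fun i _ => ?_
      rw [signAvg_sum]
      refine Finset.sum_congr rfl fun j _ => ?_
      rw [signAvg_const_mul, signAvg_rademacherSum_mul]
    -- The truncated part takes values in the cube, so `N` bounds it. Each remainder has a factor of
    -- mean-square norm at most `7 / 16`, so it costs at most `7 / 16 * S`.
    have e1 : (fun ε : Fin d → Bool => bilin M (fun i => rademacherSum (u i) ε)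
          (fun j => rademacherSum (v j) ε)) = fun ε =>
        (bilin M (fun i => clamp (rademacherSum (u i) ε)) (fun j => clamp (rademacherSum (v j) ε)) +
        bilin M (fun i => rademacherSum (u i) ε - clamp (rademacherSum (u i) ε))
          (fun j => rademacherSum (v j) ε)) +
        bilin M (fun i => clamp (rademacherSum (u i) ε))
          (fun j => rademacherSum (v j) ε - clamp (rademacherSum (v j) ε)) := by
      funext ε
      rw [add_right_comm, ← bilin_add_right]
      simp only [add_sub_cancel]
      rw [← bilin_add_left]
      simp only [add_sub_cancel]
    rw [e0, e1, signAvg_add, signAvg_add]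
    have b1 : signAvg (fun ε => bilin M (fun i => clamp (rademacherSum (u i) ε))
        (fun j => clamp (rademacherSum (v j) ε))) ≤ N := by
      rw [← signAvg_const (d := d) N]
      exact signAvg_mono fun ε => hN _ _ (fun _ => abs_clamp_le _) (fun _ => abs_clamp_le _)
    have b2 := bilin_signAvg_le M _ _ (by norm_num) (by norm_num) (h1 u hu) (h2 v hv)
    have b3 := bilin_signAvg_le M _ _ (by norm_num) (by norm_num) (h3 u hu) (h1 v hv)
    linarith
  have hmem : ∑ k, bilin M (fun i => u i k) (fun j => v j k) ∈ grothendieckValues M :=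
    ⟨d, u, v, hu, hv, rfl⟩
  have h1 : S ≤ N + 7 / 8 * S := csSup_le ⟨_, hmem⟩ step
  have h2 := le_csSup (bddAbove_grothendieckValues M) hmem
  linarith

end

open scoped MatrixOrder Matrix in
/-- A matrix whose bilinear form is at most `N` on the cube pairs to at most `8 N` with every
positive semidefinite matrix of unit diagonal. -/
lemma sum_mul_posSemidef_le {n : ℕ} (M Y : Matrix (Fin n) (Fin n) ℝ) {N : ℝ}
    (hN : ∀ x y : Fin n → ℝ, (∀ i, |x i| ≤ 1) → (∀ i, |y i| ≤ 1) → bilin M x y ≤ N)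
    (hY : Y.PosSemidef) (hdiag : ∀ i, Y i i = 1) :
    ∑ i, ∑ j, M i j * Y i j ≤ 8 * N := by
  -- The columns of `R` are Gram vectors of `Y`, and the unit diagonal makes them unit vectors.
  obtain ⟨R, hR⟩ := CStarAlgebra.nonneg_iff_eq_star_mul_self.mp hY.nonneg
  have hent : ∀ i j, Y i j = ∑ k, R k i * R k j := by
    intro i j
    rw [hR, Matrix.mul_apply]
    simp [Matrix.star_apply]
  have hu : ∀ i, ∑ k, R k i ^ 2 ≤ 1 := fun i => by
    rw [← hdiag i, hent]
    simp [sq]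
  have h := grothendieck_le M hN (fun i k => R k i) (fun i k => R k i) hu hu
  rw [sum_bilin_eq] at h
  simpa [hent] using h

/-- A bound on the bilinear form at all sign vectors extends to the cube. -/
lemma bilin_le_of_signs {ι : Type*} [Fintype ι] (M : Matrix ι ι ℝ) {N : ℝ}
    (hN : ∀ a b : ι → Bool, bilin M (fun i => boolSign (a i)) (fun j => boolSign (b j)) ≤ N)
    (x y : ι → ℝ) (hx : ∀ i, |x i| ≤ 1) (hy : ∀ i, |y i| ≤ 1) : bilin M x y ≤ N := by
  have hdual : ∀ (c z : ι → ℝ), (∀ i, |z i| ≤ 1) →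
      ∃ s : ι → Bool, ∑ i, z i * c i ≤ ∑ i, boolSign (s i) * c i := by
    intro c z hz
    refine ⟨fun i => decide (0 ≤ c i), Finset.sum_le_sum fun i _ => ?_⟩
    have hz' := abs_le.1 (hz i)
    by_cases h : 0 ≤ c i
    · simp only [h, decide_true, boolSign]
      norm_num
      nlinarith
    · simp only [h, decide_false, boolSign]
      norm_num
      nlinarith
  have hrow : ∀ x y : ι → ℝ, bilin M x y = ∑ i, x i * ∑ j, M i j * y j := by
    intro x y
    simp only [bilin, Finset.mul_sum]
    exact Finset.sum_congr rfl fun i _ => Finset.sum_congr rfl fun j _ => by ring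
  have hcol : ∀ x y : ι → ℝ, bilin M x y = ∑ j, y j * ∑ i, M i j * x i := by
    intro x y
    simp only [bilin, Finset.mul_sum]
    rw [Finset.sum_comm]
    exact Finset.sum_congr rfl fun i _ => Finset.sum_congr rfl fun j _ => by ring
  obtain ⟨a, ha⟩ := hdual (fun i => ∑ j, M i j * y j) x hx
  rw [← hrow, ← hrow _ y] at ha
  obtain ⟨b, hb⟩ := hdual (fun j => ∑ i, M i j * boolSign (a i)) y hy
  rw [← hcol (fun i => boolSign (a i)), ← hcol (fun i => boolSign (a i))] at hb
  exact ha.trans (hb.trans (hN a b))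

/-! ### Concentration of the adjacency matrix -/

section
variable {Ω : Type*} [MeasurableSpace Ω] {μ : Measure Ω} [IsProbabilityMeasure μ]

/-- Combines `exp x ≤ 1 + x + x ^ 2` for `|x| ≤ 1` with `1 + y ≤ exp y`. The exponent scales with
the probability of `s`, so sparse graphs get a Bernstein-type bound. -/
lemma mgf_centered_indicator_le {s : Set Ω} (hs : MeasurableSet s) {c t : ℝ} (hct : |t * c| ≤ 1) :
    mgf (fun ω => c * (s.indicator (fun _ => (1 : ℝ)) ω - μ.real s)) μ t ≤
      Real.exp ((t * c) ^ 2 * μ.real s) := by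
  set P := μ.real s with hP
  have hP0 : 0 ≤ P := measureReal_nonneg
  have hfun : ∀ ω, Real.exp (t * (c * (s.indicator (fun _ => (1 : ℝ)) ω - P))) =
      Real.exp (-(t * c * P)) * (1 + (Real.exp (t * c) - 1) *
        s.indicator (fun _ => (1 : ℝ)) ω) := by
    intro ω
    by_cases h : ω ∈ s
    · simp only [Set.indicator_of_mem h, mul_one, add_sub_cancel, ← Real.exp_add]
      congr 1
      ring
    · simp only [Set.indicator_of_notMem h, mul_zero, add_zero, mul_one]
      congr 1
      ring
  have hint : Integrable (s.indicator (fun _ => (1 : ℝ))) μ :=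
    (integrable_const 1).indicator hs
  have hI : ∫ ω, s.indicator (fun _ => (1 : ℝ)) ω ∂μ = P := by
    rw [integral_indicator_const _ hs]
    simp [hP]
  have hexp : Real.exp (t * c) - 1 ≤ t * c + (t * c) ^ 2 := by
    have := (abs_le.1 (Real.abs_exp_sub_one_sub_id_le hct)).2
    linarith
  unfold mgf
  simp only [hfun]
  rw [integral_const_mul, integral_add (integrable_const _) (hint.const_mul _),
    integral_const_mul, hI]
  simp only [integral_const, probReal_univ, smul_eq_mul, mul_one]
  calc Real.exp (-(t * c * P)) * (1 + (Real.exp (t * c) - 1) * P)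
      ≤ Real.exp (-(t * c * P)) * Real.exp ((t * c + (t * c) ^ 2) * P) := by
        gcongr
        have h1 := Real.add_one_le_exp ((t * c + (t * c) ^ 2) * P)
        have h2 := mul_le_mul_of_nonneg_right hexp hP0
        linarith
    _ = Real.exp ((t * c) ^ 2 * P) := by
        rw [← Real.exp_add]
        congr 1
        ring

/-- A Chernoff bound for weighted sums of independent centered indicators. -/
lemma measureReal_weighted_indicators_ge_le {ι : Type*} [Fintype ι] {s : ι → Set Ω}
    (hs : ∀ i, MeasurableSet (s i)) (hind : iIndepSet s μ) {c : ι → ℝ} (hc : ∀ i, |c i| ≤ 2)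
    {V t : ℝ} (hV : ∑ i, μ.real (s i) ≤ V) (ht : 0 ≤ t) (ht' : t ≤ 1 / 2) (a : ℝ) :
    μ.real {ω | a ≤ ∑ i, c i * ((s i).indicator (fun _ => (1 : ℝ)) ω - μ.real (s i))} ≤
      Real.exp (4 * t ^ 2 * V - t * a) := by
  set X : ι → Ω → ℝ := fun i ω => c i * ((s i).indicator (fun _ => (1 : ℝ)) ω - μ.real (s i))
    with hX
  have hindX : iIndepFun X μ :=
    (hind.iIndepFun_indicator (β := ℝ)).comp (fun i x => c i * (x - μ.real (s i)))
      (fun i => by fun_prop)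
  have hmeas : ∀ i, Measurable (X i) := fun i =>
    ((measurable_const.indicator (hs i)).sub_const _).const_mul _
  have hct : ∀ i, |t * c i| ≤ 1 := fun i => by
    rw [abs_mul, abs_of_nonneg ht]
    calc t * |c i| ≤ 1 / 2 * 2 := by
          gcongr
          exact hc i
      _ = 1 := by norm_num
  have hmgf : mgf (∑ i, X i) μ t ≤ Real.exp (4 * t ^ 2 * V) := by
    rw [hindX.mgf_sum hmeas]
    calc ∏ i, mgf (X i) μ t ≤ ∏ i, Real.exp (4 * t ^ 2 * μ.real (s i)) := by
          refine Finset.prod_le_prod (fun i _ => mgf_nonneg) fun i _ => ?_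
          refine (mgf_centered_indicator_le (hs i) (hct i)).trans ?_
          have h4 : c i ^ 2 ≤ 4 := by
            have := sq_abs (c i)
            have := hc i
            nlinarith [abs_nonneg (c i)]
          have : (t * c i) ^ 2 ≤ 4 * t ^ 2 := by
            rw [mul_pow]
            nlinarith [sq_nonneg t]
          gcongr
      _ = Real.exp (4 * t ^ 2 * ∑ i, μ.real (s i)) := by
          rw [← Real.exp_sum, Finset.mul_sum]
      _ ≤ _ := by gcongr
  have hbdd : ∀ ω, |(∑ i, X i) ω| ≤ ∑ _i : ι, (2 : ℝ) := by
    intro ω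
    rw [Finset.sum_apply]
    refine (Finset.abs_sum_le_sum_abs _ _).trans (Finset.sum_le_sum fun i _ => ?_)
    simp only [hX, abs_mul]
    have h1 : |(s i).indicator (fun _ => (1 : ℝ)) ω - μ.real (s i)| ≤ 1 := by
      have h0 : 0 ≤ μ.real (s i) := measureReal_nonneg
      have h1 : μ.real (s i) ≤ 1 := measureReal_le_one
      rw [abs_le]
      by_cases h : ω ∈ s i
      · rw [Set.indicator_of_mem h]; constructor <;> linarith
      · rw [Set.indicator_of_notMem h]; constructor <;> linarith
    exact (mul_le_mul (hc i) h1 (abs_nonneg _) (by norm_num)).trans (by norm_num)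
  have hmeasS : Measurable (∑ i, X i) := by
    have := Finset.measurable_sum Finset.univ fun i _ => hmeas i
    convert this using 1
    ext ω
    simp
  have hint : Integrable (fun ω => Real.exp (t * (∑ i, X i) ω)) μ := by
    refine Integrable.of_bound (C := Real.exp (t * ∑ _i : ι, (2 : ℝ)))
      (Real.measurable_exp.comp (hmeasS.const_mul t)).aestronglyMeasurable
      (Filter.Eventually.of_forall fun ω => ?_)
    rw [Real.norm_eq_abs, Real.abs_exp]
    have := (abs_le.1 (hbdd ω)).2
    gcongr
  have h := measure_ge_le_exp_mul_mgf a ht hint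
  simp only [Finset.sum_apply] at h
  refine h.trans ?_
  calc Real.exp (-t * a) * mgf (∑ i, X i) μ t ≤ Real.exp (-t * a) * Real.exp (4 * t ^ 2 * V) := by
        gcongr
    _ = _ := by
        rw [← Real.exp_add]
        congr 1
        ring

end

/-- A sum over ordered pairs without diagonal terms, as a sum over unordered pairs. -/
lemma sum_sum_eq_sum_lt {n : ℕ} (F : Fin n → Fin n → ℝ) (hF : ∀ i, F i i = 0) :
    ∑ i, ∑ j, F i j =
      ∑ e : {e : Fin n × Fin n // e.1 < e.2}, (F e.1.1 e.1.2 + F e.1.2 e.1.1) := by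
  have h1 : ∑ e : {e : Fin n × Fin n // e.1 < e.2}, (F e.1.1 e.1.2 + F e.1.2 e.1.1) =
      ∑ e : Fin n × Fin n, if e.1 < e.2 then F e.1 e.2 + F e.2 e.1 else 0 := by
    rw [← Finset.sum_filter]
    exact (Finset.sum_subtype _ (by simp) (fun e : Fin n × Fin n => F e.1 e.2 + F e.2 e.1)).symm
  rw [h1, Fintype.sum_prod_type]
  have h2 : ∑ i, ∑ j, (if i < j then F i j + F j i else 0) =
      ∑ i, ∑ j, (if i < j then F i j else 0) + ∑ i, ∑ j, (if j < i then F i j else 0) := by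
    conv_rhs => rw [add_comm, Finset.sum_comm, add_comm]
    simp only [← Finset.sum_add_distrib]
    refine Finset.sum_congr rfl fun i _ => Finset.sum_congr rfl fun j _ => ?_
    split_ifs <;> simp
  rw [h2]
  simp only [← Finset.sum_add_distrib]
  refine Finset.sum_congr rfl fun i _ => Finset.sum_congr rfl fun j _ => ?_
  rcases lt_trichotomy i j with h | h | h
  · simp [h, h.not_gt]
  · simp [h, hF]
  · simp [h, h.not_gt]

/-- The matrix of connection probabilities, including the diagonal. -/
def connProb {n r : ℕ} (σ : Fin n → Fin r) (θ : Fin n → ℝ) (B : Matrix (Fin r) (Fin r) ℝ) :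
    Matrix (Fin n) (Fin n) ℝ :=
  Matrix.of fun i j => θ i * θ j * B (σ i) (σ j)

lemma adj_eq_indicator {Ω : Type*} {n : ℕ} {G : Ω → SimpleGraph (Fin n)} (i j : Fin n) (ω : Ω) :
    adj (G ω) i j = {ω | (G ω).Adj i j}.indicator (fun _ => (1 : ℝ)) ω := by
  by_cases h : (G ω).Adj i j
  · have hm : ω ∈ {ω | (G ω).Adj i j} := h
    rw [Set.indicator_of_mem hm]
    simp [adj, SimpleGraph.adjMatrix_apply, h]
  · have hm : ω ∉ {ω | (G ω).Adj i j} := h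
    rw [Set.indicator_of_notMem hm]
    simp [adj, SimpleGraph.adjMatrix_apply, h]

lemma adj_symm {n : ℕ} (H : SimpleGraph (Fin n)) (i j : Fin n) : adj H i j = adj H j i := by
  classical
  unfold adj
  exact (SimpleGraph.isSymm_adjMatrix H).apply j i

section
variable {Ω : Type*} [MeasurableSpace Ω] {μ : Measure Ω} {n r : ℕ}
  {σ : Fin n → Fin r} {θ : Fin n → ℝ} {B : Matrix (Fin r) (Fin r) ℝ}
  {G : Ω → SimpleGraph (Fin n)}

lemma IsDCSBM.connProb_nonneg (h : IsDCSBM μ σ θ B G) (i j : Fin n) : 0 ≤ connProb σ θ B i j :=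
  mul_nonneg (mul_nonneg (h.theta_nonneg i) (h.theta_nonneg j)) (h.B_nonneg _ _)

lemma IsDCSBM.connProb_symm (h : IsDCSBM μ σ θ B G) (i j : Fin n) :
    connProb σ θ B i j = connProb σ θ B j i := by
  simp only [connProb, Matrix.of_apply, h.B_symm.apply (σ i) (σ j)]
  ring

variable [IsProbabilityMeasure μ]

/-- Each unordered pair carries two sign products, hence coefficients up to `2`. With `t = √(n / L)
/ 2`, the Chernoff exponent is `n - 3 n`; the hypothesis `n ≤ L` keeps `t ≤ 1 / 2`. -/
lemma IsDCSBM.measureReal_noise_ge_le (h : IsDCSBM μ σ θ B G) {L : ℝ}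
    (hL : ∑ i, ∑ j, connProb σ θ B i j ≤ L) (hnL : (n : ℝ) ≤ L) (hn : 0 < n)
    (a b : Fin n → Bool) :
    μ.real {ω | 6 * √(n * L) ≤ ∑ i, ∑ j, (if i = j then 0 else
      (adj (G ω) i j - connProb σ θ B i j) * (boolSign (a i) * boolSign (b j)))} ≤
      Real.exp (-(2 * n)) := by
  have hn' : (0 : ℝ) < n := by exact_mod_cast hn
  have hL0 : 0 < L := hn'.trans_le hnL
  have hP : ∀ e : {e : Fin n × Fin n // e.1 < e.2},
      μ.real {ω | (G ω).Adj e.1.1 e.1.2} = connProb σ θ B e.1.1 e.1.2 := fun e =>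
    h.prob_adj _ _ e.2.ne
  have hV : ∑ e : {e : Fin n × Fin n // e.1 < e.2}, μ.real {ω | (G ω).Adj e.1.1 e.1.2} ≤ L := by
    refine le_trans ?_ hL
    rw [← Fintype.sum_prod_type' (fun i j => connProb σ θ B i j)]
    simp only [hP]
    rw [← Finset.sum_subtype (Finset.univ.filter fun e : Fin n × Fin n => e.1 < e.2) (by simp)
      (fun e : Fin n × Fin n => connProb σ θ B e.1 e.2)]
    exact Finset.sum_le_sum_of_subset_of_nonneg (Finset.subset_univ _)
      fun e _ _ => h.connProb_nonneg _ _
  have hsgn : ∀ c : Bool, |boolSign c| = 1 := by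
    intro c
    cases c <;> simp [boolSign]
  set c : {e : Fin n × Fin n // e.1 < e.2} → ℝ := fun e =>
    boolSign (a e.1.1) * boolSign (b e.1.2) + boolSign (a e.1.2) * boolSign (b e.1.1) with hcdef
  have hc : ∀ e, |c e| ≤ 2 := fun e => by
    refine (abs_add_le _ _).trans ?_
    simp only [abs_mul, hsgn]
    norm_num
  have hle1 : √(n / L) ≤ 1 := by
    exact Real.sqrt_le_one.2 ((div_le_one hL0).2 hnL)
  have key := measureReal_weighted_indicators_ge_le (fun e => h.measurableSet_adj e.1.1 e.1.2)
    h.indep_adj hc hV (t := √(n / L) / 2) (by positivity) (by linarith) (6 * √(n * L))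
  have hexp : 4 * (√(n / L) / 2) ^ 2 * L - √(n / L) / 2 * (6 * √(n * L)) = -(2 * n) := by
    have h1 : √(n / L) * √(n * L) = n := by
      rw [← Real.sqrt_mul (by positivity), div_mul_eq_mul_div, mul_div_assoc, mul_div_assoc,
        div_self hL0.ne', mul_one, Real.sqrt_mul_self hn'.le]
    have h2 : √(n / L) ^ 2 * L = n := by
      rw [Real.sq_sqrt (by positivity), div_mul_cancel₀ _ hL0.ne']
    linear_combination h2 - 3 * h1
  rw [hexp] at key
  refine le_trans (le_of_eq ?_) key
  congr 1
  ext ω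
  simp only [Set.mem_ofPred_eq]
  rw [sum_sum_eq_sum_lt _ (by simp)]
  apply iff_of_eq
  congr 1
  refine Finset.sum_congr rfl fun e _ => ?_
  rw [if_neg e.2.ne, if_neg e.2.ne', hP, adj_symm (G ω) e.1.2, h.connProb_symm e.1.2,
    adj_eq_indicator, hcdef]
  ring

/-- With high probability, the adjacency matrix is close to the matrix of connection probabilities
in the cut norm. -/
lemma IsDCSBM.le_measureReal_noise (h : IsDCSBM μ σ θ B G) {L : ℝ}
    (hL : ∑ i, ∑ j, connProb σ θ B i j ≤ L) (hnL : (n : ℝ) ≤ L) (hn : 0 < n) :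
    1 - (Real.exp 1 / 2) ^ (-(2 * (n : ℝ))) ≤
      μ.real {ω | ∀ a b : Fin n → Bool, ∑ i, ∑ j, (if i = j then 0 else
      (adj (G ω) i j - connProb σ θ B i j) * (boolSign (a i) * boolSign (b j))) ≤
        6 * √(n * L)} := by
  set S := {ω | ∀ a b : Fin n → Bool, ∑ i, ∑ j, (if i = j then 0 else
      (adj (G ω) i j - connProb σ θ B i j) * (boolSign (a i) * boolSign (b j))) ≤
        6 * √(n * L)} with hS
  set bad : (Fin n → Bool) × (Fin n → Bool) → Set Ω := fun ab =>
    {ω | 6 * √(n * L) ≤ ∑ i, ∑ j, (if i = j then 0 else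
      (adj (G ω) i j - connProb σ θ B i j) * (boolSign (ab.1 i) * boolSign (ab.2 j)))} with hbad
  have hcover : (Set.univ : Set Ω) ⊆ S ∪ ⋃ ab, bad ab := by
    intro ω _
    by_cases hω : ω ∈ S
    · exact Or.inl hω
    · refine Or.inr ?_
      simp only [hS, Set.mem_ofPred_eq, not_forall, not_le] at hω
      obtain ⟨a, b, hab⟩ := hω
      exact Set.mem_iUnion.2 ⟨(a, b), hab.le⟩
  have h1 : (1 : ℝ) ≤ μ.real S + μ.real (⋃ ab, bad ab) := by
    calc (1 : ℝ) = μ.real Set.univ := by simp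
      _ ≤ μ.real (S ∪ ⋃ ab, bad ab) := measureReal_mono hcover
      _ ≤ _ := measureReal_union_le _ _
  have h2 : μ.real (⋃ ab, bad ab) ≤ ∑ _ab : (Fin n → Bool) × (Fin n → Bool),
      Real.exp (-(2 * n)) :=
    (measureReal_iUnion_fintype_le _).trans
      (Finset.sum_le_sum fun ab _ => h.measureReal_noise_ge_le hL hnL hn ab.1 ab.2)
  have h3 : ∑ _ab : (Fin n → Bool) × (Fin n → Bool), Real.exp (-(2 * n)) =
      (Real.exp 1 / 2) ^ (-(2 * (n : ℝ))) := by
    rw [Finset.sum_const, Finset.card_univ, Fintype.card_prod, Fintype.card_fun, nsmul_eq_mul,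
      Real.rpow_neg (by positivity), ← Nat.cast_ofNat (n := 2), ← Nat.cast_mul, Real.rpow_natCast,
      div_pow, ← Real.exp_nat_mul, Real.exp_neg]
    simp only [Fintype.card_bool, Fintype.card_fin, mul_one]
    push_cast
    field_simp
    ring
  linarith

end

/-! ### Rounding by weighted `k`-median -/

/-- The cluster matrix of a labelling. -/
def clusterMatrix {n r : ℕ} (σ : Fin n → Fin r) : Matrix (Fin n) (Fin n) ℝ :=
  Matrix.of fun i j => if σ i = σ j then 1 else 0

/-- The entrywise `ℓ₁` distance with weights `w i * w j`. -/
def weightedDist {n : ℕ} (w : Fin n → ℝ) (Y Z : Matrix (Fin n) (Fin n) ℝ) : ℝ :=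
  ∑ i, ∑ j, w i * w j * |Y i j - Z i j|

section
variable {n r : ℕ} {σ : Fin n → Fin r} {θ : Fin n → ℝ} {g : ℝ}

lemma clusterMatrix_nonneg (i j : Fin n) : 0 ≤ clusterMatrix σ i j := by
  simp only [clusterMatrix, Matrix.of_apply]
  split_ifs <;> norm_num

lemma clusterMatrix_le_one (i j : Fin n) : clusterMatrix σ i j ≤ 1 := by
  simp only [clusterMatrix, Matrix.of_apply]
  split_ifs <;> norm_num

lemma sum_mul_clusterMatrix (i : Fin n) :
    ∑ j, θ j * clusterMatrix σ i j = clusterWeight σ θ (σ i) := by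
  simp [clusterMatrix, clusterWeight, Finset.sum_filter, eq_comm]

lemma sum_theta_filter_mem (hg : ∀ a, clusterWeight σ θ a = g) (S : Finset (Fin r)) :
    ∑ i with σ i ∈ S, θ i = S.card * g := by
  have h := Finset.sum_fiberwise_of_maps_to (s := Finset.univ.filter fun i => σ i ∈ S) (t := S)
    (g := σ) (by simp) θ
  rw [← h, ← nsmul_eq_mul, ← Finset.sum_const]
  refine Finset.sum_congr rfl fun a ha => ?_
  rw [← hg a, clusterWeight, Finset.filter_filter]
  refine Finset.sum_congr ?_ fun _ _ => rfl
  ext i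
  simp only [Finset.mem_filter, Finset.mem_univ, true_and]
  exact ⟨fun h => h.2, fun h => ⟨h ▸ ha, h⟩⟩

/-- If the rows assigned by `t` are close to the true rows, then up to a relabelling most nodes
are classified correctly. -/
lemma exists_perm_sum_misclassified_le (hθ : ∀ i, 0 ≤ θ i)
    (hg : ∀ a, clusterWeight σ θ a = g) (hg0 : 0 < g) (t : Fin n → Fin r)
    (y : Fin r → Fin n → ℝ) {ξ : ℝ}
    (hξ : weightedDist θ (Matrix.of fun i => y (t i)) (clusterMatrix σ) ≤ ξ) :
    ∃ π : Equiv.Perm (Fin r), ∑ i with π (t i) ≠ σ i, θ i ≤ 2 * (ξ / g) := by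
  classical
  set err : Fin n → ℝ := fun i => ∑ j, θ j * |y (t i) j - clusterMatrix σ i j| with herr
  -- Markov's inequality at threshold `g`: true rows of different clusters are at weighted distance
  -- `2 * g`, so two nodes below the threshold cannot share a label unless their clusters agree.
  have hbad : ∑ i with g ≤ err i, θ i ≤ ξ / g := by
    rw [le_div_iff₀ hg0, Finset.sum_mul]
    refine le_trans ?_ hξ
    calc ∑ i with g ≤ err i, θ i * g ≤ ∑ i with g ≤ err i, θ i * err i :=
          Finset.sum_le_sum fun i hi =>
            mul_le_mul_of_nonneg_left (Finset.mem_filter.1 hi).2 (hθ i)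
      _ ≤ ∑ i, θ i * err i :=
          Finset.sum_le_sum_of_subset_of_nonneg (Finset.subset_univ _) fun i _ _ =>
            mul_nonneg (hθ i) (Finset.sum_nonneg fun j _ => mul_nonneg (hθ j) (abs_nonneg _))
      _ = _ := by
          simp only [weightedDist, herr, Finset.mul_sum, Matrix.of_apply, mul_assoc]
  have hsep : ∀ i j, err i < g → err j < g → t i = t j → σ i = σ j := by
    intro i j hi hj hij
    by_contra hne
    have h1 : ∑ k, θ k * (clusterMatrix σ i k + clusterMatrix σ j k) = 2 * g := by
      simp only [mul_add, Finset.sum_add_distrib, sum_mul_clusterMatrix, hg]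
      ring
    have h2 : ∑ k, θ k * (clusterMatrix σ i k + clusterMatrix σ j k) ≤ err i + err j := by
      simp only [herr, ← Finset.sum_add_distrib, ← mul_add]
      refine Finset.sum_le_sum fun k _ => mul_le_mul_of_nonneg_left ?_ (hθ k)
      rw [hij]
      have h3 : clusterMatrix σ i k + clusterMatrix σ j k ≤
          |clusterMatrix σ i k - clusterMatrix σ j k| := by
        simp only [clusterMatrix, Matrix.of_apply]
        by_cases h : σ i = σ k
        · have : ¬ σ j = σ k := fun h' => hne (h.trans h'.symm)
          simp [h, this]
        · by_cases h' : σ j = σ k <;> simp [h, h']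
      have h4 := abs_sub_le (clusterMatrix σ i k) (y (t j) k) (clusterMatrix σ j k)
      rw [abs_sub_comm (clusterMatrix σ i k) (y (t j) k)] at h4
      linarith
    linarith
  set R : Finset (Fin r) := Finset.univ.filter fun a => ∃ i, err i < g ∧ σ i = a with hR
  have hrep : ∀ a : Fin r, ∃ b, a ∈ R → ∃ i, err i < g ∧ σ i = a ∧ t i = b := by
    intro a
    by_cases ha : a ∈ R
    · obtain ⟨i, hi, hia⟩ := (Finset.mem_filter.1 ha).2
      exact ⟨t i, fun _ => ⟨i, hi, hia, rfl⟩⟩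
    · exact ⟨a, fun h => absurd h ha⟩
  choose l hl using hrep
  have hlinj : Set.InjOn l R := by
    intro a ha b hb hab
    obtain ⟨i, hi, hia, hti⟩ := hl a ha
    obtain ⟨j, hj, hjb, htj⟩ := hl b hb
    rw [← hia, ← hjb]
    exact hsep i j hi hj (by rw [hti, htj, hab])
  -- Clusters in `R` contain a good node and claim one of its labels; the remaining clusters take
  -- the leftover labels arbitrarily.
  obtain ⟨e, he⟩ := Finset.exists_equiv_extend_of_card_eq (t := (Finset.univ : Finset (Fin r)))
    (by simp) (Finset.subset_univ (R.image l)) hlinj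
  let e' : Equiv.Perm (Fin r) := e.trans (Equiv.subtypeUnivEquiv (by simp))
  have he' : ∀ a ∈ R, e' a = l a := he
  set R3 : Finset (Fin r) := R.filter fun a => ∃ i, err i < g ∧ σ i = a ∧ t i ≠ l a with hR3
  have hrep3 : ∀ a : Fin r, ∃ b, a ∈ R3 → b ≠ l a ∧ ∃ i, err i < g ∧ σ i = a ∧ t i = b := by
    intro a
    by_cases ha : a ∈ R3
    · obtain ⟨i, hi, hia, hne⟩ := (Finset.mem_filter.1 ha).2
      exact ⟨t i, fun _ => ⟨hne, i, hi, hia, rfl⟩⟩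
    · exact ⟨a, fun h => absurd h ha⟩
  choose l' hl' using hrep3
  have hl'inj : Set.InjOn l' R3 := by
    intro a ha b hb hab
    obtain ⟨-, i, hi, hia, hti⟩ := hl' a ha
    obtain ⟨-, j, hj, hjb, htj⟩ := hl' b hb
    rw [← hia, ← hjb]
    exact hsep i j hi hj (by rw [hti, htj, hab])
  have hdisj : Disjoint (R3.image l') (R.image l) := by
    rw [Finset.disjoint_left]
    intro b hb hb'
    obtain ⟨a, ha, rfl⟩ := Finset.mem_image.1 hb
    obtain ⟨a', ha', heq⟩ := Finset.mem_image.1 hb'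
    obtain ⟨hne, i, hi, hia, hti⟩ := hl' a ha
    obtain ⟨j, hj, hja, htj⟩ := hl a' ha'
    have : a = a' := by
      rw [← hia, ← hja]
      exact hsep i j hi hj (by rw [hti, htj, heq])
    exact hne (this ▸ heq.symm)
  -- Each cluster split among several labels by its good nodes uses up a second label, so it must be
  -- paid for by a cluster with no good node. Since all clusters weigh `g`, the split ones weigh no
  -- more than the bad nodes.
  have hcard : R3.card ≤ Rᶜ.card := by
    have h1 := Finset.card_le_univ (R3.image l' ∪ R.image l)
    rw [Finset.card_union_of_disjoint hdisj, Finset.card_image_of_injOn hl'inj,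
      Finset.card_image_of_injOn hlinj] at h1
    rw [Finset.card_compl]
    omega
  have hRc : (Rᶜ.card : ℝ) * g ≤ ∑ i with g ≤ err i, θ i := by
    rw [← sum_theta_filter_mem hg]
    refine Finset.sum_le_sum_of_subset_of_nonneg ?_ fun i _ _ => hθ i
    intro i hi
    simp only [hR, Finset.mem_filter, Finset.mem_univ, true_and, Finset.mem_compl, not_exists,
      not_and] at hi ⊢
    by_contra hlt
    exact hi i (not_le.1 hlt) rfl
  have hR3w : ∑ i with σ i ∈ R3, θ i ≤ ∑ i with g ≤ err i, θ i := by
    rw [sum_theta_filter_mem hg]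
    refine le_trans ?_ hRc
    have : (R3.card : ℝ) ≤ Rᶜ.card := by exact_mod_cast hcard
    gcongr
  refine ⟨e'.symm, ?_⟩
  calc ∑ i with e'.symm (t i) ≠ σ i, θ i
      ≤ ∑ i ∈ (Finset.univ.filter fun i => g ≤ err i) ∪ (Finset.univ.filter fun i => σ i ∈ R3),
          θ i := by
        refine Finset.sum_le_sum_of_subset_of_nonneg ?_ fun i _ _ => hθ i
        intro i hi
        simp only [Finset.mem_filter, Finset.mem_univ, true_and, Finset.mem_union] at hi ⊢
        by_cases hgi : g ≤ err i
        · exact Or.inl hgi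
        · refine Or.inr ?_
          have hiR : σ i ∈ R := by
            simp only [hR, Finset.mem_filter, Finset.mem_univ, true_and]
            exact ⟨i, not_le.1 hgi, rfl⟩
          refine Finset.mem_filter.2 ⟨hiR, i, not_le.1 hgi, rfl, fun hti => hi ?_⟩
          rw [hti, ← he' _ hiR, Equiv.symm_apply_apply]
    _ ≤ ∑ i with g ≤ err i, θ i + ∑ i with σ i ∈ R3, θ i := by
        rw [← Finset.sum_union_inter]
        have : 0 ≤ ∑ i ∈ (Finset.univ.filter fun i => g ≤ err i) ∩
            (Finset.univ.filter fun i => σ i ∈ R3), θ i := Finset.sum_nonneg fun i _ => hθ i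
        linarith
    _ ≤ 2 * (ξ / g) := by linarith

lemma IsMembership.exists_label {Ψ : Matrix (Fin n) (Fin r) ℝ} (h : IsMembership Ψ) :
    ∃ t : Fin n → Fin r, Ψ = trueMembership t := by
  choose t ht huniq using h.existsUnique
  refine ⟨t, ?_⟩
  ext i a
  simp only [trueMembership, Matrix.of_apply]
  split_ifs with hia
  · rw [← hia]; exact ht i
  · exact (h.zero_or_one i a).resolve_right fun h1 => hia (huniq i a h1).symm

lemma isMembership_trueMembership (t : Fin n → Fin r) : IsMembership (trueMembership t) where
  zero_or_one i a := by
    simp only [trueMembership, Matrix.of_apply]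
    split_ifs <;> simp
  existsUnique i := by
    refine ⟨t i, by simp [trueMembership], fun a ha => ?_⟩
    by_contra hne
    simp [trueMembership, Ne.symm hne] at ha

lemma trueMembership_mul_apply (t : Fin n → Fin r) {m : ℕ} (X : Matrix (Fin r) (Fin m) ℝ)
    (i : Fin n) (j : Fin m) :
    (trueMembership t * X) i j = X (t i) j := by
  simp [Matrix.mul_apply, trueMembership]

lemma misclassifiedWeight_trueMembership_le (hθ : ∀ i, 0 ≤ θ i) (t : Fin n → Fin r)
    (π : Equiv.Perm (Fin r)) :
    misclassifiedWeight σ θ (trueMembership t) ≤ ∑ i with π (t i) ≠ σ i, θ i := by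
  refine (Finset.inf'_le _ (Finset.mem_univ π)).trans ?_
  refine Finset.sum_le_sum_of_subset_of_nonneg ?_ fun i _ _ => hθ i
  intro i hi
  simp only [misclassified, Finset.mem_filter, Finset.mem_univ, true_and] at hi ⊢
  rintro hπ
  obtain ⟨a, ha⟩ := hi
  apply ha
  rw [trueMembership_mul_apply]
  simp [trueMembership, Equiv.Perm.permMatrix, PEquiv.toMatrix_apply, hπ, eq_comm]

lemma kMedianCost_eq (A Y : Matrix (Fin n) (Fin n) ℝ) (hd : ∀ i, 0 ≤ deg A i)
    (t : Fin n → Fin r) (X : Matrix (Fin r) (Fin n) ℝ) (c : Fin r → Fin n)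
    (hX : ∀ a j, X a j = featureMatrix A Y (c a) j) :
    kMedianCost (deg A) (featureMatrix A Y) (trueMembership t) X =
      weightedDist (deg A) (Matrix.of fun i => Y (c (t i))) Y := by
  unfold kMedianCost weightedDist
  refine Finset.sum_congr rfl fun i _ => Finset.sum_congr rfl fun j _ => ?_
  rw [Matrix.diagonal_mul, Matrix.sub_apply, trueMembership_mul_apply, hX]
  simp only [featureMatrix, Matrix.mul_diagonal, Matrix.of_apply]
  rw [← sub_mul, abs_mul, abs_mul, abs_of_nonneg (hd i), abs_of_nonneg (hd j)]
  ring

lemma weightedDist_comm (w : Fin n → ℝ) (Y Z : Matrix (Fin n) (Fin n) ℝ) :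
    weightedDist w Y Z = weightedDist w Z Y := by
  simp only [weightedDist, abs_sub_comm]

lemma weightedDist_triangle {w : Fin n → ℝ} (hw : ∀ i, 0 ≤ w i)
    (X Y Z : Matrix (Fin n) (Fin n) ℝ) :
    weightedDist w X Z ≤ weightedDist w X Y + weightedDist w Y Z := by
  simp only [weightedDist, ← Finset.sum_add_distrib, ← mul_add]
  refine Finset.sum_le_sum fun i _ => Finset.sum_le_sum fun j _ => ?_
  exact mul_le_mul_of_nonneg_left (abs_sub_le _ _ _) (mul_nonneg (hw i) (hw j))

/-- Every cluster has a row whose use as a center costs at most twice the distance to the cluster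
matrix. -/
lemma exists_centers {w : Fin n → ℝ} (hw : ∀ i, 0 ≤ w i) (Y : Matrix (Fin n) (Fin n) ℝ)
    (hσ : Function.Surjective σ) :
    ∃ c : Fin r → Fin n, weightedDist w (Matrix.of fun i => Y (c (σ i))) Y ≤
      2 * weightedDist w Y (clusterMatrix σ) := by
  -- The center of a cluster is its row of `Y` nearest to the true row, which is constant on the
  -- cluster.
  have hc : ∀ a, ∃ k, σ k = a ∧ ∀ i, σ i = a →
      ∑ j, w j * |Y k j - clusterMatrix σ k j| ≤ ∑ j, w j * |Y i j - clusterMatrix σ i j| := by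
    intro a
    obtain ⟨i, hi⟩ := hσ a
    obtain ⟨k, hk, hmin⟩ := Finset.exists_min_image (Finset.univ.filter fun i => σ i = a)
      (fun i => ∑ j, w j * |Y i j - clusterMatrix σ i j|) ⟨i, by simpa using hi⟩
    exact ⟨k, by simpa using hk, fun i hi => hmin i (by simpa using hi)⟩
  choose c hcσ hcmin using hc
  refine ⟨c, (weightedDist_triangle hw _ (clusterMatrix σ) _).trans ?_⟩
  rw [weightedDist_comm w (clusterMatrix σ), two_mul]
  gcongr
  unfold weightedDist
  refine Finset.sum_le_sum fun i _ => ?_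
  simp only [mul_assoc, ← Finset.mul_sum]
  refine mul_le_mul_of_nonneg_left ?_ (hw i)
  have h := hcmin (σ i) i rfl
  have h2 : ∀ j, clusterMatrix σ (c (σ i)) j = clusterMatrix σ i j := fun j => by
    simp [clusterMatrix, hcσ]
  simpa [h2] using h

/-- The rows selected by an approximate solution of the `k`-median problem are close to the
cluster matrix. -/
lemma IsKMedianApprox.exists_label {A Y : Matrix (Fin n) (Fin n) ℝ} (hd : ∀ i, 0 ≤ deg A i)
    (hσ : Function.Surjective σ) {Ψ : Matrix (Fin n) (Fin r) ℝ} {X : Matrix (Fin r) (Fin n) ℝ}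
    (h : IsKMedianApprox (deg A) (featureMatrix A Y) Ψ X) :
    ∃ (t : Fin n → Fin r) (c : Fin r → Fin n), Ψ = trueMembership t ∧
      weightedDist (deg A) (Matrix.of fun i => Y (c (t i))) (clusterMatrix σ) ≤
        43 / 3 * weightedDist (deg A) Y (clusterMatrix σ) := by
  obtain ⟨⟨hΨ, hX⟩, Ψ₀, X₀, ⟨-, hopt⟩, hcost⟩ := h
  obtain ⟨t, rfl⟩ := hΨ.exists_label
  choose c hc using hX
  refine ⟨t, c, rfl, ?_⟩
  obtain ⟨c₁, hc₁⟩ := exists_centers hd Y hσ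
  have h1 := hopt (trueMembership σ) (Matrix.of fun a => featureMatrix A Y (c₁ a))
    ⟨isMembership_trueMembership σ, fun a => ⟨c₁ a, fun j => rfl⟩⟩
  rw [kMedianCost_eq A Y hd σ (Matrix.of fun a => featureMatrix A Y (c₁ a)) c₁
    (fun _ _ => rfl)] at h1
  rw [kMedianCost_eq A Y hd t X c hc] at hcost
  -- The constant is `20 / 3 * 2 + 1 = 43 / 3`.
  have h2 := weightedDist_triangle hd (Matrix.of fun i => Y (c (t i))) Y (clusterMatrix σ)
  linarith

end

/-- Changing the weights from `f` to `f + e` changes a sum with coefficients in `[-1, 1]` by at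
most `2 L N + N ^ 2`. -/
lemma abs_sum_weights_sub_le {n : ℕ} {f d : Fin n → ℝ} {L N : ℝ} (hf : ∀ i, 0 ≤ f i)
    (hL : ∑ i, f i ≤ L) (hN : ∑ i, |d i - f i| ≤ N) (m : Fin n → Fin n → ℝ)
    (hm : ∀ i j, |m i j| ≤ 1) :
    |∑ i, ∑ j, d i * d j * m i j - ∑ i, ∑ j, f i * f j * m i j| ≤ 2 * L * N + N ^ 2 := by
  have hN0 : 0 ≤ ∑ i, |d i - f i| := Finset.sum_nonneg fun _ _ => abs_nonneg _
  have hL0 : 0 ≤ ∑ i, f i := Finset.sum_nonneg fun i _ => hf i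
  calc |∑ i, ∑ j, d i * d j * m i j - ∑ i, ∑ j, f i * f j * m i j|
      = |∑ i, ∑ j, (d i * d j - f i * f j) * m i j| := by
        simp only [← Finset.sum_sub_distrib, sub_mul]
    _ ≤ ∑ i, ∑ j, |(d i * d j - f i * f j) * m i j| :=
        (Finset.abs_sum_le_sum_abs _ _).trans
          (Finset.sum_le_sum fun i _ => Finset.abs_sum_le_sum_abs _ _)
    _ ≤ ∑ i, ∑ j, (f i * |d j - f j| + |d i - f i| * f j + |d i - f i| * |d j - f j|) := by
        refine Finset.sum_le_sum fun i _ => Finset.sum_le_sum fun j _ => ?_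
        rw [abs_mul]
        calc |d i * d j - f i * f j| * |m i j| ≤ |d i * d j - f i * f j| * 1 := by
              gcongr
              exact hm i j
          _ = |f i * (d j - f j) + (d i - f i) * f j + (d i - f i) * (d j - f j)| := by
              rw [mul_one]
              congr 1
              ring
          _ ≤ |f i * (d j - f j)| + |(d i - f i) * f j| + |(d i - f i) * (d j - f j)| :=
              abs_add_three _ _ _
          _ = _ := by
              simp only [abs_mul, abs_of_nonneg (hf i), abs_of_nonneg (hf j)]
    _ = 2 * (∑ i, f i) * (∑ i, |d i - f i|) + (∑ i, |d i - f i|) ^ 2 := by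
        simp only [Finset.sum_add_distrib, ← Finset.sum_mul_sum]
        ring
    _ ≤ 2 * L * N + N ^ 2 := by
        have := hL0.trans hL
        gcongr

/-! ### The convex relaxation -/

section
variable {n r : ℕ} {σ : Fin n → Fin r} {θ : Fin n → ℝ} {g : ℝ}

open scoped ComplexOrder in
lemma cvxFeasible_clusterMatrix (σ : Fin n → Fin r) : CvxFeasible (clusterMatrix σ) where
  posSemidef := by
    have h : clusterMatrix σ = trueMembership σ * (trueMembership σ).conjTranspose := by
      ext i j
      rw [trueMembership_mul_apply]
      simp [clusterMatrix, trueMembership, eq_comm]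
    rw [h]
    exact Matrix.posSemidef_self_mul_conjTranspose _
  nonneg := clusterMatrix_nonneg
  le_one := clusterMatrix_le_one
  diag_eq_one i := by simp [clusterMatrix]

lemma deg_adj_nonneg (H : SimpleGraph (Fin n)) (i : Fin n) : 0 ≤ deg (adj H) i := by
  refine Finset.sum_nonneg fun j _ => ?_
  simp only [adj, SimpleGraph.adjMatrix_apply]
  split_ifs <;> norm_num

/-- Test the form on the signs of the row sums against the all-ones vector. For `M = A - P` this
bounds the total degree error. -/
lemma sum_abs_row_sum_le {M : Matrix (Fin n) (Fin n) ℝ} {N : ℝ}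
    (hN : ∀ x y : Fin n → ℝ, (∀ i, |x i| ≤ 1) → (∀ i, |y i| ≤ 1) → bilin M x y ≤ N) :
    ∑ i, |∑ j, M i j| ≤ N := by
  refine le_trans (le_of_eq ?_) (hN (fun i => SignType.sign (∑ j, M i j)) (fun _ => 1) ?_ (by simp))
  · refine Finset.sum_congr rfl fun i _ => ?_
    rw [← sign_mul_self, Finset.mul_sum]
    exact Finset.sum_congr rfl fun j _ => by ring
  · intro i
    rcases SignType.sign (∑ j, M i j) with _ | _ | _ <;> simp

/-- The optimal solution of the convex relaxation is close to the cluster matrix, if the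
adjacency matrix is close to its expectation. -/
lemma IsCvxOptimal.mul_weightedDist_le {A P Y : Matrix (Fin n) (Fin n) ℝ} {f : Fin n → ℝ}
    {lam δ L N : ℝ} (hlam : 0 ≤ lam) (hf : ∀ i, 0 ≤ f i) (hL : ∑ i, f i ≤ L)
    (hPf : ∀ i, ∑ j, P i j = f i)
    (hin : ∀ i j, σ i = σ j → δ * (θ i * θ j) ≤ P i j - lam * (f i * f j))
    (hout : ∀ i j, σ i ≠ σ j → P i j - lam * (f i * f j) ≤ -(δ * (θ i * θ j)))
    (hN : ∀ x y : Fin n → ℝ, (∀ i, |x i| ≤ 1) → (∀ i, |y i| ≤ 1) → bilin (A - P) x y ≤ N)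
    (hY : IsCvxOptimal A lam Y) :
    δ * weightedDist θ Y (clusterMatrix σ) ≤ 16 * N + lam * (2 * L * N + N ^ 2) := by
  set Z := clusterMatrix σ with hZ
  have hZf : CvxFeasible Z := cvxFeasible_clusterMatrix σ
  have h1 : ∑ i, ∑ j, (A - P) i j * Y i j ≤ 8 * N :=
    sum_mul_posSemidef_le _ _ hN hY.1.posSemidef hY.1.diag_eq_one
  have h2 : ∑ i, ∑ j, (-(A - P)) i j * Z i j ≤ 8 * N := by
    refine sum_mul_posSemidef_le _ _ (fun x y hx hy => ?_) hZf.posSemidef hZf.diag_eq_one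
    refine le_trans (le_of_eq ?_) (hN (fun i => -x i) y (by simpa using hx) hy)
    unfold bilin
    refine Finset.sum_congr rfl fun i _ => Finset.sum_congr rfl fun j _ => ?_
    rw [Matrix.neg_apply]
    ring
  have hdiff : ∑ i, |deg A i - f i| ≤ N := by
    refine le_trans (le_of_eq ?_) (sum_abs_row_sum_le hN)
    refine Finset.sum_congr rfl fun i _ => ?_
    simp [deg, ← hPf, Finset.sum_sub_distrib]
  have h3 := (abs_le.1 (abs_sum_weights_sub_le hf hL hdiff (fun i j => Z i j - Y i j) (fun i j => by
    rw [abs_le]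
    have := hZf.nonneg i j
    have := hZf.le_one i j
    have := hY.1.nonneg i j
    have := hY.1.le_one i j
    constructor <;> linarith))).2
  have h4 := hY.2 Z hZf
  have h5 : δ * weightedDist θ Y Z ≤ ∑ i, ∑ j, (Z i j - Y i j) * (P i j - lam * (f i * f j)) := by
    unfold weightedDist
    simp only [Finset.mul_sum]
    refine Finset.sum_le_sum fun i _ => Finset.sum_le_sum fun j _ => ?_
    by_cases h : σ i = σ j
    · have hz : Z i j = 1 := by simp [hZ, clusterMatrix, h]
      have hy := hY.1.le_one i j
      rw [hz, abs_of_nonpos (by linarith)]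
      nlinarith [hin i j h]
    · have hz : Z i j = 0 := by simp [hZ, clusterMatrix, h]
      have hy := hY.1.nonneg i j
      rw [hz, sub_zero, abs_of_nonneg hy]
      nlinarith [hout i j h]
  have h6 : ∑ i, ∑ j, (Z i j - Y i j) * (P i j - lam * (f i * f j)) =
      (cvxObjective A lam Z - cvxObjective A lam Y) + ∑ i, ∑ j, (A - P) i j * Y i j +
      ∑ i, ∑ j, (-(A - P)) i j * Z i j +
      lam * (∑ i, ∑ j, deg A i * deg A j * (Z i j - Y i j) -
        ∑ i, ∑ j, f i * f j * (Z i j - Y i j)) := by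
    simp only [cvxObjective, Finset.mul_sum, ← Finset.sum_sub_distrib, ← Finset.sum_add_distrib,
      Matrix.sub_apply, Matrix.neg_apply]
    refine Finset.sum_congr rfl fun i _ => Finset.sum_congr rfl fun j _ => ?_
    ring
  have h7 := mul_le_mul_of_nonneg_left h3 hlam
  linarith

end

/-! ### ### The balanced model and assembly of the bound -/

section
variable {Ω : Type*} [MeasurableSpace Ω] {μ : Measure Ω} {n r : ℕ} {p q g δ lam : ℝ}
  {σ : Fin n → Fin r} {θ : Fin n → ℝ} {B : Matrix (Fin r) (Fin r) ℝ}
  {G : Ω → SimpleGraph (Fin n)}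

namespace IsFModel

lemma one_le_g (h : IsFModel μ p q g σ θ B G) : 1 ≤ g := by
  obtain ⟨i, hi⟩ := h.exists_theta_eq_one
  rw [← hi, ← h.clusterWeight_eq (σ i)]
  exact Finset.single_le_sum (f := θ) (fun j _ => h.theta_nonneg j) (by simp)

lemma surjective (h : IsFModel μ p q g σ θ B G) : Function.Surjective σ := by
  intro a
  by_contra hne
  push Not at hne
  have h1 := h.clusterWeight_eq a
  have h2 := h.one_le_g
  simp only [clusterWeight, hne, Finset.filter_false, Finset.sum_empty] at h1
  linarith

lemma B_eq (h : IsFModel μ p q g σ θ B G) (a b : Fin r) : B a b = if a = b then p else q := by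
  split_ifs with hab
  · rw [hab, h.B_diag]
  · rcases lt_or_gt_of_ne hab with hlt | hgt
    · exact h.B_offDiag a b hlt
    · rw [h.B_symm.apply b a]
      exact h.B_offDiag b a hgt

lemma sum_theta (h : IsFModel μ p q g σ θ B G) : ∑ j, θ j = r * g := by
  simpa using sum_theta_filter_mem h.clusterWeight_eq Finset.univ

lemma sum_connProb (h : IsFModel μ p q g σ θ B G) (i : Fin n) :
    ∑ j, connProb σ θ B i j = θ i * (g * (p + (r - 1) * q)) := by
  have h1 : ∀ j, connProb σ θ B i j =
      q * θ i * θ j + (p - q) * θ i * (θ j * clusterMatrix σ i j) := by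
    intro j
    simp only [connProb, clusterMatrix, Matrix.of_apply, h.B_eq]
    split_ifs <;> ring
  simp only [h1, Finset.sum_add_distrib, ← Finset.mul_sum]
  rw [h.sum_theta, sum_mul_clusterMatrix, h.clusterWeight_eq]
  ring

lemma misclassifiedWeight_le_total (h : IsFModel μ p q g σ θ B G)
    {Ψ : Matrix (Fin n) (Fin r) ℝ} (hΨ : IsMembership Ψ) :
    misclassifiedWeight σ θ Ψ ≤ r * g := by
  obtain ⟨t, rfl⟩ := hΨ.exists_label
  refine (misclassifiedWeight_trueMembership_le h.theta_nonneg t 1).trans ?_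
  rw [← h.sum_theta]
  exact Finset.sum_le_sum_of_subset_of_nonneg (Finset.subset_univ _)
    fun i _ _ => h.theta_nonneg i

end IsFModel

/-- A bound on the off-diagonal noise at all sign vectors bounds the whole noise on the cube. -/
lemma IsDCSBM.bilin_noise_le (h : IsDCSBM μ σ θ B G) {L : ℝ} (hnL : (n : ℝ) ≤ L) {ω : Ω}
    (hω : ∀ a b : Fin n → Bool, ∑ i, ∑ j, (if i = j then 0 else
      (adj (G ω) i j - connProb σ θ B i j) * (boolSign (a i) * boolSign (b j))) ≤ 6 * √(n * L))
    (x y : Fin n → ℝ) (hx : ∀ i, |x i| ≤ 1) (hy : ∀ i, |y i| ≤ 1) :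
    bilin (adj (G ω) - connProb σ θ B) x y ≤ 7 * √(n * L) := by
  refine bilin_le_of_signs _ (fun a b => ?_) x y hx hy
  have hn : (n : ℝ) ≤ √(n * L) := by
    refine Real.le_sqrt_of_sq_le ?_
    rw [sq]
    gcongr
  have hsgn : ∀ c : Bool, |boolSign c| = 1 := by
    intro c
    cases c <;> simp [boolSign]
  -- The graph has no loops, but keeping the diagonal of `P` makes its row sums exact. The price is
  -- at most `n ≤ √(n * L)`, which turns `6` into `7`.
  have hdiag : ∀ i, (adj (G ω) - connProb σ θ B) i i * (boolSign (a i) * boolSign (b i)) ≤ 1 := by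
    intro i
    refine (le_abs_self _).trans ?_
    rw [abs_mul, abs_mul, hsgn, hsgn, mul_one, mul_one, Matrix.sub_apply]
    have h0 : adj (G ω) i i = 0 := by simp [adj, SimpleGraph.adjMatrix_apply]
    rw [h0, zero_sub, abs_neg, abs_of_nonneg (h.connProb_nonneg i i)]
    exact h.prob_le_one i i
  have hsplit : bilin (adj (G ω) - connProb σ θ B) (fun i => boolSign (a i))
      (fun j => boolSign (b j)) =
      ∑ i, ∑ j, (if i = j then 0 else
        (adj (G ω) i j - connProb σ θ B i j) * (boolSign (a i) * boolSign (b j))) +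
      ∑ i, (adj (G ω) - connProb σ θ B) i i * (boolSign (a i) * boolSign (b i)) := by
    unfold bilin
    rw [← Finset.sum_add_distrib]
    refine Finset.sum_congr rfl fun i _ => ?_
    have h1 : (adj (G ω) - connProb σ θ B) i i * (boolSign (a i) * boolSign (b i)) =
        ∑ j, if i = j then (adj (G ω) - connProb σ θ B) i j * (boolSign (a i) * boolSign (b j))
          else 0 := by simp
    rw [h1, ← Finset.sum_add_distrib]
    refine Finset.sum_congr rfl fun j _ => ?_
    split_ifs <;> simp
  rw [hsplit]
  have h1 := Finset.sum_le_sum fun i (_ : i ∈ Finset.univ) => hdiag i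
  simp only [Finset.sum_const, Finset.card_univ, Fintype.card_fin, nsmul_eq_mul, mul_one] at h1
  linarith [hω a b]

/-- On the event that the noise is small, every approximate solution misclassifies few nodes. -/
lemma IsFModel.misclassifiedWeight_le (h : IsFModel μ p q g σ θ B G) (hr : 2 ≤ r) (hδ : 0 < δ)
    (hgap : 2 * δ < p - q)
    (hlam1 : (q + δ) / ((p + ((r : ℝ) - 1) * q) ^ 2 * g ^ 2) < lam)
    (hlam2 : lam < (p - δ) / ((p + ((r : ℝ) - 1) * q) ^ 2 * g ^ 2))
    (hnL : (n : ℝ) ≤ r * g * (g * (p + (r - 1) * q))) {ω : Ω}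
    (hω : ∀ a b : Fin n → Bool, ∑ i, ∑ j, (if i = j then 0 else
      (adj (G ω) i j - connProb σ θ B i j) * (boolSign (a i) * boolSign (b j))) ≤
        6 * √(n * (r * g * (g * (p + (r - 1) * q)))))
    {Y : Matrix (Fin n) (Fin n) ℝ} {Ψ : Matrix (Fin n) (Fin r) ℝ} {X : Matrix (Fin r) (Fin n) ℝ}
    (hY : IsCvxOptimal (adj (G ω)) lam Y)
    (hX : IsKMedianApprox (deg (adj (G ω))) (featureMatrix (adj (G ω)) Y) Ψ X) :
    misclassifiedWeight σ θ Ψ ≤ 7000 * (r / δ) * (r * √(n * p)) := by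
  have hg1 := h.one_le_g
  have hg0 : 0 < g := by linarith
  have hr' : (2 : ℝ) ≤ r := by exact_mod_cast hr
  have hq : 0 ≤ q := by
    have h1 : B ⟨0, by omega⟩ ⟨1, by omega⟩ = q := h.B_offDiag _ _ (by simp)
    rw [← h1]
    exact h.B_nonneg _ _
  have hp : 0 < p := by linarith
  set K : ℝ := p + (r - 1) * q with hK
  have hKp : p ≤ K := by nlinarith
  have hK0 : 0 < K := by linarith
  have hKr : K ≤ r * p := by nlinarith
  set H : ℝ := g * K with hH
  have hH0 : 0 < H := by positivity
  set L : ℝ := r * g * H with hLdef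
  have hL0 : 0 < L := by positivity
  set N : ℝ := 7 * √(n * L) with hN
  have hN0 : 0 ≤ N := by positivity
  have hHsq : K ^ 2 * g ^ 2 = H ^ 2 := by rw [hH]; ring
  rw [hHsq, div_lt_iff₀ (by positivity)] at hlam1
  rw [hHsq, lt_div_iff₀ (by positivity)] at hlam2
  have hlam0 : 0 ≤ lam := by
    by_contra hneg
    nlinarith [sq_nonneg H]
  have hf : ∀ i, 0 ≤ θ i * H := fun i => mul_nonneg (h.theta_nonneg i) hH0.le
  have hfL : ∑ i, θ i * H ≤ L := by
    rw [← Finset.sum_mul, h.sum_theta]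
  have hnoise := h.toIsDCSBM.bilin_noise_le hnL hω
  have hNsq : N ^ 2 ≤ 7 * (L * N) := by
    have h1 : √(n * L) ≤ L := by
      refine Real.sqrt_le_iff.2 ⟨hL0.le, ?_⟩
      rw [sq]
      gcongr
    rw [hN]
    nlinarith [Real.sqrt_nonneg (n * L)]
  have hweights : 2 * L * N + N ^ 2 ≤ 9 * (L * N) := by linarith
  -- Here `L * K = r * H ^ 2` and `lam * H ^ 2 < p - δ ≤ K`.
  have hlamL : lam * L ≤ r := by
    have h1 : lam * L * K = lam * H ^ 2 * r := by rw [hLdef, hH]; ring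
    have h2 : lam * L * K ≤ r * K := by rw [h1]; nlinarith
    exact le_of_mul_le_mul_right h2 hK0
  have hdist : δ * weightedDist θ Y (clusterMatrix σ) ≤ 25 * r * N := by
    have h1 := hY.mul_weightedDist_le (σ := σ) (θ := θ) (δ := δ) hlam0 hf hfL
      (P := connProb σ θ B) h.sum_connProb ?_ ?_ hnoise
    · have h2 : lam * (2 * L * N + N ^ 2) ≤ 9 * (r * N) := by
        calc lam * (2 * L * N + N ^ 2) ≤ lam * (9 * (L * N)) := by gcongr
          _ = 9 * (lam * L * N) := by ring
          _ ≤ 9 * (r * N) := by gcongr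
      nlinarith
    · intro i j hij
      have h0 := mul_nonneg (h.theta_nonneg i) (h.theta_nonneg j)
      simp only [connProb, Matrix.of_apply, h.B_eq, if_pos hij]
      have h1 : δ ≤ p - lam * H ^ 2 := by linarith
      linarith [mul_le_mul_of_nonneg_right h1 h0]
    · intro i j hij
      have h0 := mul_nonneg (h.theta_nonneg i) (h.theta_nonneg j)
      simp only [connProb, Matrix.of_apply, h.B_eq, if_neg hij]
      have h1 : δ ≤ lam * H ^ 2 - q := by linarith
      linarith [mul_le_mul_of_nonneg_right h1 h0]
  have hdiff : ∑ i, |deg (adj (G ω)) i - θ i * H| ≤ N := by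
    refine le_trans (le_of_eq ?_) (sum_abs_row_sum_le hnoise)
    refine Finset.sum_congr rfl fun i _ => ?_
    rw [← h.sum_connProb i]
    simp [deg, Finset.sum_sub_distrib]
  have hd := deg_adj_nonneg (G ω)
  have htransfer : ∀ W : Matrix (Fin n) (Fin n) ℝ, (∀ i j, 0 ≤ W i j ∧ W i j ≤ 1) →
      |weightedDist (deg (adj (G ω))) W (clusterMatrix σ) -
        H ^ 2 * weightedDist θ W (clusterMatrix σ)| ≤ 9 * (L * N) := by
    intro W hW
    have h1 := abs_sum_weights_sub_le hf hfL hdiff (fun i j => |W i j - clusterMatrix σ i j|)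
      (fun i j => by
        rw [abs_abs, abs_le]
        have := hW i j
        have := clusterMatrix_nonneg (σ := σ) i j
        have := clusterMatrix_le_one (σ := σ) i j
        constructor <;> linarith)
    have h2 : ∑ i, ∑ j, θ i * H * (θ j * H) * |W i j - clusterMatrix σ i j| =
        H ^ 2 * weightedDist θ W (clusterMatrix σ) := by
      simp only [weightedDist, Finset.mul_sum]
      exact Finset.sum_congr rfl fun i _ => Finset.sum_congr rfl fun j _ => by ring
    rw [h2] at h1
    exact h1.trans hweights
  obtain ⟨t, c, rfl, hround⟩ := hX.exists_label hd h.surjective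
  have h1 := (abs_le.1 (htransfer Y fun i j => ⟨hY.1.nonneg i j, hY.1.le_one i j⟩)).2
  have h2 := (abs_le.1 (htransfer (Matrix.of fun i => Y (c (t i)))
    fun i j => ⟨hY.1.nonneg _ j, hY.1.le_one _ j⟩)).1
  -- Weights are exchanged once on each side of the rounding bound: `43 / 3 * 9 + 9 = 138`.
  have h3 : H ^ 2 * weightedDist θ (Matrix.of fun i => Y (c (t i))) (clusterMatrix σ) ≤
      H ^ 2 * (43 / 3 * weightedDist θ Y (clusterMatrix σ)) + 138 * (L * N) := by linarith
  have hLN : 138 * (L * N) ≤ H ^ 2 * (138 * (r / δ * N)) := by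
    have e1 : L * N * δ = r * g * H * N * δ := by rw [hLdef]
    have e2 : H ^ 2 * (138 * (r / δ * N)) = 138 * (r * g * H * N * K) / δ := by
      rw [hH]
      ring
    rw [e2, le_div_iff₀ hδ, mul_assoc, e1]
    have : δ ≤ K := by linarith
    gcongr
  have hη : weightedDist θ Y (clusterMatrix σ) ≤ 25 * (r / δ * N) := by
    have : 25 * (r / δ * N) = 25 * r * N / δ := by ring
    rw [this, le_div_iff₀ hδ]
    linarith
  -- `43 / 3 * 25 + 138 < 500`; the final constant is then `2 * 500 * 7 = 7000`.
  have hξ : weightedDist θ (Matrix.of fun i => Y (c (t i))) (clusterMatrix σ) ≤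
      500 * (r / δ * N) := by
    have h4 : weightedDist θ (Matrix.of fun i => Y (c (t i))) (clusterMatrix σ) ≤
        43 / 3 * weightedDist θ Y (clusterMatrix σ) + 138 * (r / δ * N) := by
      refine le_of_mul_le_mul_left (?_ : H ^ 2 * _ ≤ H ^ 2 * _) (by positivity)
      linarith
    have : 0 ≤ r / δ * N := by positivity
    linarith
  obtain ⟨π, hπ⟩ := exists_perm_sum_misclassified_le h.theta_nonneg h.clusterWeight_eq hg0 t
    (fun a => Y (c a)) hξ
  refine (misclassifiedWeight_trueMembership_le h.theta_nonneg t π).trans (hπ.trans ?_)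
  have hsqrt : √(n * L) ≤ r * g * √(n * p) := by
    refine Real.sqrt_le_iff.2 ⟨by positivity, ?_⟩
    rw [mul_pow, Real.sq_sqrt (by positivity), hLdef, hH]
    calc (n : ℝ) * (r * g * (g * K)) ≤ n * (r * g * (g * (r * p))) := by gcongr
      _ = _ := by ring
  calc 2 * (500 * (r / δ * N) / g) ≤ 2 * (500 * (r / δ * (7 * (r * g * √(n * p)))) / g) := by
        have : N ≤ 7 * (r * g * √(n * p)) := mul_le_mul_of_nonneg_left hsqrt (by norm_num)
        gcongr
    _ = 7000 * (r / δ) * (r * √(n * p)) := by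
        field_simp
        ring

end

end DCSBM

open DCSBM in
theorem theorem2 :
    ∃ C₀ : ℝ, 0 < C₀ ∧
      ∀ (Ω : Type*) [MeasurableSpace Ω] (μ : Measure Ω) [IsProbabilityMeasure μ]
        (n r : ℕ) (p q g δ lam : ℝ) (σ : Fin n → Fin r) (θ : Fin n → ℝ)
        (B : Matrix (Fin r) (Fin r) ℝ) (G : Ω → SimpleGraph (Fin n)),
        DCSBM.IsFModel μ p q g σ θ B G →
        0 < δ →
        2 * δ < p - q →
        (q + δ) / ((p + ((r : ℝ) - 1) * q) ^ 2 * g ^ 2) < lam →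
        lam < (p - δ) / ((p + ((r : ℝ) - 1) * q) ^ 2 * g ^ 2) →
        0.99 - 2 * (Real.exp 1 / 2) ^ (-(2 * (n : ℝ))) ≤
          μ.real {ω | ∀ (Y : Matrix (Fin n) (Fin n) ℝ)
            (Ψ : Matrix (Fin n) (Fin r) ℝ) (X : Matrix (Fin r) (Fin n) ℝ),
            DCSBM.IsCvxOptimal (DCSBM.adj (G ω)) lam Y →
            DCSBM.IsKMedianApprox (DCSBM.deg (DCSBM.adj (G ω)))
              (DCSBM.featureMatrix (DCSBM.adj (G ω)) Y) Ψ X →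
            DCSBM.misclassifiedWeight σ θ Ψ ≤
              C₀ * ((r : ℝ) / δ) * ((n : ℝ) / g + (r : ℝ) * Real.sqrt ((n : ℝ) * p))} := by
  refine ⟨7000, by norm_num, ?_⟩
  intro Ω _ μ _ n r p q g δ lam σ θ B G h hδ hgap hlam1 hlam2
  have hg1 := h.one_le_g
  have hg0 : 0 < g := by linarith
  have hpow : 0 < (Real.exp 1 / 2) ^ (-(2 * (n : ℝ))) := by positivity
  have hsure : ∀ S : Set Ω, (∀ ω, ω ∈ S) →
      0.99 - 2 * (Real.exp 1 / 2) ^ (-(2 * (n : ℝ))) ≤ μ.real S := by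
    intro S hS
    rw [Set.eq_univ_of_forall hS, probReal_univ]
    norm_num
    linarith
  obtain ⟨i₀, -⟩ := h.exists_theta_eq_one
  have hn : 0 < n := i₀.pos
  rcases lt_or_ge r 2 with hr | hr
  -- With a single label nothing can be misclassified. This case is separate because no pair of
  -- labels then forces `q ≥ 0`.
  · refine hsure _ fun ω Y Ψ X _ hX => ?_
    have : Subsingleton (Fin r) := Fin.subsingleton_iff_le_one.2 (by omega)
    obtain ⟨t, rfl⟩ := hX.1.1.exists_label
    refine (misclassifiedWeight_trueMembership_le h.theta_nonneg t 1).trans ?_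
    rw [Finset.filter_false_of_mem fun i _ => not_not.2 (Subsingleton.elim _ _),
      Finset.sum_empty]
    positivity
  have hr' : (2 : ℝ) ≤ r := by exact_mod_cast hr
  have hq : 0 ≤ q := by
    have h1 : B ⟨0, by omega⟩ ⟨1, by omega⟩ = q := h.B_offDiag _ _ (by simp)
    rw [← h1]
    exact h.B_nonneg _ _
  rcases lt_or_ge (r * g * (g * (p + (r - 1) * q))) (n : ℝ) with hL | hL
  -- Too sparse for concentration: `δ * g ^ 2 ≤ r * g ^ 2 * K < n`, so even total misclassification
  -- satisfies the bound.
  · refine hsure _ fun ω Y Ψ X _ hX => ?_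
    refine (h.misclassifiedWeight_le_total hX.1.1).trans ?_
    have h1 : g * δ ≤ n / g := by
      rw [le_div_iff₀ hg0]
      have h2 : δ ≤ r * (p + (r - 1) * q) := by
        have h3 : δ ≤ p + (r - 1) * q := by nlinarith
        nlinarith
      calc g * δ * g ≤ g * (r * (p + (r - 1) * q)) * g := by gcongr
        _ ≤ n := by linarith
    have h2 : g ≤ 1 / δ * (n / g) := by
      rw [one_div_mul_eq_div, le_div_iff₀ hδ]
      exact h1
    calc (r : ℝ) * g ≤ r * (1 / δ * (n / g)) := by gcongr
      _ = 1 * (r / δ) * (n / g + 0) := by ring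
      _ ≤ 7000 * (r / δ) * (n / g + r * √(n * p)) := by
          gcongr
          · norm_num
          · positivity
  · have hsum : ∑ i, ∑ j, connProb σ θ B i j ≤ r * g * (g * (p + (r - 1) * q)) := by
      simp only [h.sum_connProb]
      rw [← Finset.sum_mul, h.sum_theta]
    have hprob := h.toIsDCSBM.le_measureReal_noise hsum hL hn
    refine le_trans ?_ (hprob.trans (measureReal_mono ?_))
    · norm_num
      linarith
    · intro ω hω Y Ψ X hY hX
      refine (h.misclassifiedWeight_le hr hδ hgap hlam1 hlam2 hL hω hY hX).trans ?_
      gcongr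
      have : 0 ≤ (n : ℝ) / g := by positivity
      linarith
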